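/- Let $K$ be an algebraically closed field of prime characteristic $p \neq 2,3$, let $A,B\in K$ with $4A^3+27B^2\neq 0$, and let $E : y^2=x^3+Ax+B$. Let $\tilde E(K[\varepsilon])$, $\varepsilon^2=0$, be the group of points $(X:Y:Z)$ of the same equation $Y^2Z=X^3+AXZ^2+BZ^3$ over the dual numbers $K[\varepsilon]$; it contains $E(K)$ and the group of points at infinity $\Theta=\{\mathcal O_k=(k\varepsilon:1:0) : k\in K\}$. Let $O = \mathcal O_0$. Let $R\in E[p]$ with $R\notin E[2]$ (so $E$ is ordinary), and let $T$ be a point of order two. For $P\in E[p]$, $P\neq O$, and $i,j \geq 1$ with $i+j\le p$ let $\ell_{i,j}$ be the line through $iP$ and $jP$ (the tangent line if $iP=jP$), written $y-mx-b$ if $i+j \neq p$, let $v_i=x-x(iP)$, let $\tau$ be translation by $-T$, and put $h_{i,j}=(\ell_{i,j}/v_{i+j})\circ\tau$ if $i+j\neq p$ and $h_{i,j}=v_i\circ\tau$ if $i+j=p$. An addition chain for $p$ is a set $S\subseteq\{1,\dots,p\}$ containing $p$ in which each $k>1$ is a sum of two members of $S$; an addition chain decomposition $C$ of $p$ is a finite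 sequence of steps $(i+j\mapsto i,j)$ with $i,j,i+j\in S$, for an addition chain $S$ for $p$, which decomposes $p$ into a sum of $p$ ones. Define, for $P\in E[p]$ and $k\in K$, $$e(P,\mathcal O_k)=\prod_{(i+j\mapsto i,j)\in C}\frac{h_{i,j}(\mathcal O_k+R)}{h_{i,j}(R)}\quad\text{if } P\neq O \text{ and } k\neq 0,\qquad e(P,\mathcal O_k)=1 \quad\text{if } P=O\text{ or }k=0.$$ Then: 1. $e$ is a well-defined map $E[p]\times\Theta\to\mu_p(K[\varepsilon])$: each $h_{i,j}$ occurring in the product is evaluated, after translation, at affine points of $\tilde E(K[\varepsilon])$ where its denominator is invertible, each $h_{i,j}(R)$ is invertible, and the values of $e$ are $p$-th roots of unity. 2. $e$ does not depend on the addition chain decomposition $C$ of $p$. 3. $e$ is bilinear: $e(P+P',Q)=e(P,Q)\,e(P',Q)$ and $e(P,Q+Q')=e(P,Q)\,e(P,Q')$ for $P,P'\in E[p]$ and $Q,Q'\in\Theta$. 4. Let $P\in E[p]$, let $D_P$ be any divisor of degree $0$ on $E$ that sums to $P$, let $f_P$ be any function on $E$ with divisor $pD_P$, and let $f_P'=\frac{d}{dx}f_P$.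 Then for every $R'\in E(K)$ the function $y f_P'/f_P$ is regular at $R'$, and for all $k\in K$ $$e(P,\mathcal O_k)=1-2\Big(y\,\frac{f_P'}{f_P}\Big)(R')\,k\,\varepsilon .$$ In particular $e$ does not depend on the choice of $R$ or of $T$. -/

import Mathlib

open scoped DualNumber
open WeierstrassCurve.Projective (PointClass)

namespace DualPairing

/-! ### The curve and its points over a commutative ring -/

section Curve

variable {S : Type*} [CommRing S]

/-- The Weierstrass curve `y² = x³ + a x + b` over a commutative ring. -/
abbrev curve (a b : S) : WeierstrassCurve.Affine S :=
  { a₁ := 0, a₂ := 0, a₃ := 0, a₄ := a, a₆ := b }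

/-- The first of two bihomogeneous addition laws on `Y²Z = X³ + aXZ² + bZ³`. At a pair `(P, Q)` of
points of an elliptic curve over a field it is nonzero exactly when `P ≠ Q`, and then it gives `P + Q`. -/
def addLaw₁ (a b : S) (P Q : Fin 3 → S) : Fin 3 → S :=
  ![(P 0 * Q 1 - Q 0 * P 1) * (P 1 * Q 2 + Q 1 * P 2)
      + (P 0 * Q 2 - Q 0 * P 2) * P 1 * Q 1
      - a * (P 0 * Q 2 + Q 0 * P 2) * (P 0 * Q 2 - Q 0 * P 2)
      - 3 * b * (P 0 * Q 2 - Q 0 * P 2) * P 2 * Q 2,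
    -3 * P 0 * Q 0 * (P 0 * Q 1 - Q 0 * P 1)
      - P 1 * Q 1 * (P 1 * Q 2 - Q 1 * P 2)
      - a * (P 0 * Q 1 - Q 0 * P 1) * P 2 * Q 2
      + a * (P 0 * Q 2 + Q 0 * P 2) * (P 1 * Q 2 - Q 1 * P 2)
      + 3 * b * (P 1 * Q 2 - Q 1 * P 2) * P 2 * Q 2,
    3 * P 0 * Q 0 * (P 0 * Q 2 - Q 0 * P 2)
      - (P 1 * Q 2 + Q 1 * P 2) * (P 1 * Q 2 - Q 1 * P 2)
      + a * (P 0 * Q 2 - Q 0 * P 2) * P 2 * Q 2]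

/-- The second of two bihomogeneous addition laws on `Y²Z = X³ + aXZ² + bZ³`. At a pair `(P, Q)` of
points of an elliptic curve over a field it is nonzero exactly when `P - Q` is not of order two, and then it gives
`P + Q`. -/
def addLaw₂ (a b : S) (P Q : Fin 3 → S) : Fin 3 → S :=
  ![P 1 * Q 1 * (P 0 * Q 1 + Q 0 * P 1)
      - a * P 0 * Q 0 * (P 1 * Q 2 + Q 1 * P 2)
      - a * (P 0 * Q 1 + Q 0 * P 1) * (P 0 * Q 2 + Q 0 * P 2)
      - 3 * b * (P 0 * Q 1 + Q 0 * P 1) * P 2 * Q 2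
      - 3 * b * (P 0 * Q 2 + Q 0 * P 2) * (P 1 * Q 2 + Q 1 * P 2)
      + a ^ 2 * (P 1 * Q 2 + Q 1 * P 2) * P 2 * Q 2,
    P 1 ^ 2 * Q 1 ^ 2 + 3 * a * P 0 ^ 2 * Q 0 ^ 2
      + 9 * b * P 0 * Q 0 * (P 0 * Q 2 + Q 0 * P 2)
      - a ^ 2 * P 0 * Q 2 * (P 0 * Q 2 + 2 * Q 0 * P 2)
      - a ^ 2 * Q 0 * P 2 * (2 * P 0 * Q 2 + Q 0 * P 2)
      - 3 * a * b * P 2 * Q 2 * (P 0 * Q 2 + Q 0 * P 2)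
      - (a ^ 3 + 9 * b ^ 2) * P 2 ^ 2 * Q 2 ^ 2,
    3 * P 0 * Q 0 * (P 0 * Q 1 + Q 0 * P 1)
      + P 1 * Q 1 * (P 1 * Q 2 + Q 1 * P 2)
      + a * (P 0 * Q 1 + Q 0 * P 1) * P 2 * Q 2
      + a * (P 0 * Q 2 + Q 0 * P 2) * (P 1 * Q 2 + Q 1 * P 2)
      + 3 * b * (P 1 * Q 2 + Q 1 * P 2) * P 2 * Q 2]

lemma addLaw₁_smul (a b u v : S) (P Q : Fin 3 → S) :
    addLaw₁ a b (u • P) (v • Q) = (u * v) ^ 2 • addLaw₁ a b P Q := by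
  ext i
  fin_cases i <;> simp [addLaw₁] <;> ring

lemma addLaw₂_smul (a b u v : S) (P Q : Fin 3 → S) :
    addLaw₂ a b (u • P) (v • Q) = (u * v) ^ 2 • addLaw₂ a b P Q := by
  ext i
  fin_cases i <;> simp [addLaw₂] <;> ring

/-- Over a local ring: `(X, Y, Z)` generates the unit ideal, so it represents a point of `ℙ²`. -/
def IsPrimitive (P : Fin 3 → S) : Prop :=
  ∃ i, IsUnit (P i)

lemma isPrimitive_smul {u : S} (hu : IsUnit u) (P : Fin 3 → S) :
    IsPrimitive (u • P) ↔ IsPrimitive P := by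
  simp [IsPrimitive, hu]

open Classical in
/-- Addition of representatives of points over a local ring: the first addition law where it is
defined, the second one otherwise. -/
noncomputable def addRep (a b : S) (P Q : Fin 3 → S) : Fin 3 → S :=
  if IsPrimitive (addLaw₁ a b P Q) then addLaw₁ a b P Q else addLaw₂ a b P Q

lemma addRep_smul (a b : S) {u v : S} (hu : IsUnit u) (hv : IsUnit v) (P Q : Fin 3 → S) :
    addRep a b (u • P) (v • Q) = (u * v) ^ 2 • addRep a b P Q := by
  by_cases h : IsPrimitive (addLaw₁ a b P Q) <;>
    simp [addRep, addLaw₁_smul, addLaw₂_smul, isPrimitive_smul ((hu.mul hv).pow 2), h]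

/-- The addition of classes `(X : Y : Z)` over a local ring. On points of the curve it is the group
law of the curve. -/
noncomputable def addClass (a b : S) (P Q : PointClass S) : PointClass S :=
  Quotient.map₂ (addRep a b) (by
    rintro _ P ⟨u, rfl⟩ _ Q ⟨v, rfl⟩
    refine ⟨(u * v) ^ 2, ?_⟩
    simpa [Units.smul_def] using (addRep_smul a b u.isUnit v.isUnit P Q).symm) P Q

/-- The points `(X : Y : Z)` of `Y²Z = X³ + aXZ² + bZ³` over a local ring. -/
def points (a b : S) : Set (PointClass S) :=
  {P | ∃ X : Fin 3 → S, P = ⟦X⟧ ∧ IsPrimitive X ∧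
    WeierstrassCurve.Projective.Equation (curve a b) X}

end Curve

section Field

variable {K : Type*} [Field K] {A B : K}

/-- Projective coordinates of a point of `E : y² = x³ + A x + B` over the field `K`. -/
def coords : (curve A B).Point → Fin 3 → K
  | .zero => ![0, 1, 0]
  | .some x y _ => ![x, y, 1]

/-! ### The canonical lift `Ẽ` to the dual numbers -/

/-- The point at infinity `O_k = (kε : 1 : 0)`. -/
def infPt (k : K) : PointClass K[ε] :=
  ⟦![k • DualNumber.eps, 1, 0]⟧

/-- The set `Θ` of the points at infinity. -/
def Θ (K : Type*) [Field K] : Set (PointClass K[ε]) :=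
  Set.range infPt

/-- A point of `E(K)`, regarded as a point of the canonical lift. -/
def liftPt (P : (curve A B).Point) : PointClass K[ε] :=
  ⟦fun i => algebraMap K K[ε] (coords P i)⟧

/-- The points of the canonical lift `Ẽ(K[ε])`. -/
def dualPoints (A B : K) : Set (PointClass K[ε]) :=
  points (algebraMap K K[ε] A) (algebraMap K K[ε] B)

/-- The addition of the canonical lift `Ẽ(K[ε])`. -/
noncomputable def dualAdd (A B : K) (P Q : PointClass K[ε]) : PointClass K[ε] :=
  addClass (algebraMap K K[ε] A) (algebraMap K K[ε] B) P Q

/-! ### Lines and the functions `h_{i,j}` -/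

/-- The linear form `L 0 * X + L 1 * Y + L 2 * Z`, evaluated over the dual numbers. -/
def evalForm (L : Fin 3 → K) (X : Fin 3 → K[ε]) : K[ε] :=
  ∑ i, algebraMap K K[ε] (L i) * X i

lemma evalForm_smul (L : Fin 3 → K) (u : K[ε]) (X : Fin 3 → K[ε]) :
    evalForm L (u • X) = u * evalForm L X := by
  simp only [evalForm, Finset.mul_sum, Pi.smul_apply, smul_eq_mul]
  exact Finset.sum_congr rfl fun _ _ => by ring

/-- The value at a point over `K[ε]` of the function `N / D`, for linear forms `N` and `D`. It is
meaningful where `D` is invertible, see `RatioDefined`. -/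
noncomputable def ratio (N D : Fin 3 → K) (Q : PointClass K[ε]) : K[ε] :=
  Quotient.lift (fun X => evalForm N X * Ring.inverse (evalForm D X)) (by
    rintro _ X ⟨u, rfl⟩
    simp only [Units.smul_def, evalForm_smul, Ring.mul_inverse_rev, Ring.inverse_unit]
    linear_combination (evalForm N X * Ring.inverse (evalForm D X)) * u.mul_inv) Q

/-- The denominator of `N / D` is invertible at a point over `K[ε]`. -/
def RatioDefined (D : Fin 3 → K) (Q : PointClass K[ε]) : Prop :=
  ∃ X : Fin 3 → K[ε], Q = ⟦X⟧ ∧ IsUnit (evalForm D X)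

/-- The vertical line through `P`, namely `x - x(P) = 0` (the line at infinity if `P = O`). -/
def vertical : (curve A B).Point → Fin 3 → K
  | .zero => ![0, 0, 1]
  | .some x _ _ => ![1, 0, -x]

variable [DecidableEq K]

/-- The line through `P` and `Q`, the tangent line if `P = Q`: it is `y - y₁ - m (x - x₁) = 0` for
the slope `m`, or a vertical line if `P + Q = O` or one of `P`, `Q` is `O`. -/
def line : (curve A B).Point → (curve A B).Point → Fin 3 → K
  | .zero, Q => vertical Q
  | P, .zero => vertical P
  | .some x₁ y₁ _, .some x₂ y₂ _ =>
    if x₁ = x₂ ∧ y₁ = -y₂ then ![1, 0, -x₁]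
    else
      let m := (curve A B).slope x₁ x₂ y₁ y₂
      ![-m, 1, m * x₁ - y₁]

/-- The numerator of `h_{i,j}`, before the translation: `ℓ_{i,j}`, or `v_i` if `i + j = p`. -/
def hNum (p : ℕ) (P : (curve A B).Point) (i j : ℕ) : Fin 3 → K :=
  if i + j = p then vertical (i • P) else line (i • P) (j • P)

/-- The denominator of `h_{i,j}`, before the translation: `v_{i+j}`, or `1` (as a form, `Z`) if
`i + j = p`. -/
def hDen (p : ℕ) (P : (curve A B).Point) (i j : ℕ) : Fin 3 → K :=
  if i + j = p then ![0, 0, 1] else vertical ((i + j) • P)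

/-- Translation by `-T` on the canonical lift. -/
noncomputable def translate (T : (curve A B).Point) (Q : PointClass K[ε]) : PointClass K[ε] :=
  dualAdd A B Q (liftPt (-T))

/-- The value at a point `Q` of `Ẽ(K[ε])` of the function `h_{i,j}`, which is `(ℓ_{i,j} / v_{i+j}) ∘ τ`
if `i + j ≠ p` and `v_i ∘ τ` if `i + j = p`, where `τ` is the translation by `-T`. -/
noncomputable def hVal (p : ℕ) (T P : (curve A B).Point) (i j : ℕ) (Q : PointClass K[ε]) : K[ε] :=
  ratio (hNum p P i j) (hDen p P i j) (translate T Q)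

/-- The function `h_{i,j}` is defined at `Q`: the translate of `Q` is an affine point of `Ẽ(K[ε])`
and the denominator of `h_{i,j}` is invertible there. -/
def HDefined (p : ℕ) (T P : (curve A B).Point) (i j : ℕ) (Q : PointClass K[ε]) : Prop :=
  translate T Q ∈ dualPoints A B ∧ (∃ x y : K[ε], translate T Q = ⟦![x, y, 1]⟧) ∧
    RatioDefined (hDen p P i j) (translate T Q)

end Field

/-! ### Addition chains -/

/-- `S` is an addition chain for `n`: a set of integers in `{1, …, n}` that contains `n` and in which
every `k > 1` is a sum of two members. -/
def IsAdditionChain (n : ℕ) (S : Finset ℕ) : Prop :=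
  S ⊆ Finset.Icc 1 n ∧ n ∈ S ∧ ∀ k ∈ S, 1 < k → ∃ i ∈ S, ∃ j ∈ S, i + j = k

/-- `Decomposes S M C`: the steps `(i + j ↦ i, j)` with `(i, j)` in the list `C`, and
`i, j, i + j ∈ S`, applied one after the other, turn the multiset `M` into a multiset of ones. -/
inductive Decomposes (S : Finset ℕ) : Multiset ℕ → List (ℕ × ℕ) → Prop
  | ones (m : ℕ) : Decomposes S (Multiset.replicate m 1) []
  | step {i j : ℕ} {M : Multiset ℕ} {C : List (ℕ × ℕ)} (hi : i ∈ S) (hj : j ∈ S)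
      (hij : i + j ∈ S) (h : Decomposes S (i ::ₘ j ::ₘ M) C) :
      Decomposes S ((i + j) ::ₘ M) ((i, j) :: C)

/-- `C` is an addition chain decomposition of `n`: for some addition chain for `n`, its steps
decompose `n` into a sum of `n` ones. -/
def IsChainDecomposition (n : ℕ) (C : List (ℕ × ℕ)) : Prop :=
  ∃ S, IsAdditionChain n S ∧ Decomposes S {n} C

section Field

variable {K : Type*} [Field K] [DecidableEq K] {A B : K}

/-! ### The map `e` -/

open Classical in
/-- The map `e`, computed with the evaluation point `R`, the point `T` of order two and the
addition chain decomposition `C`: the product over `C` of `h_{i,j}(Q + R) / h_{i,j}(R)`, and `1` if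
`P = O` or `Q = O`. -/
noncomputable def pairing (p : ℕ) (R T : (curve A B).Point) (C : List (ℕ × ℕ))
    (P : (curve A B).Point) (Q : PointClass K[ε]) : K[ε] :=
  if P = 0 ∨ Q = infPt 0 then 1
  else (C.map fun s => hVal p T P s.1 s.2 (dualAdd A B Q (liftPt R)) *
    Ring.inverse (hVal p T P s.1 s.2 (liftPt R))).prod

end Field

section Functions

variable {K : Type*} [Field K] {A B : K}

/-! ### Functions on `E`, their derivatives and divisors -/

/-- The coordinate function `x` in the function field `K(E)`. -/
noncomputable def xF (A B : K) : (curve A B).FunctionField :=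
  algebraMap (curve A B).CoordinateRing _
    (WeierstrassCurve.Affine.CoordinateRing.mk _ (Polynomial.C Polynomial.X))

/-- The coordinate function `y` in the function field `K(E)`. -/
noncomputable def yF (A B : K) : (curve A B).FunctionField :=
  algebraMap (curve A B).CoordinateRing _
    (WeierstrassCurve.Affine.CoordinateRing.mk _ Polynomial.X)

/-- The equation of the curve holds for the coordinate functions. -/
lemma yF_sq : yF A B ^ 2 = xF A B ^ 3 + algebraMap K _ A * xF A B + algebraMap K _ B := by
  have h : WeierstrassCurve.Affine.CoordinateRing.mk (curve A B) (curve A B).polynomial = 0 :=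
    AdjoinRoot.mk_self
  have h' := congrArg (algebraMap (curve A B).CoordinateRing (curve A B).FunctionField) h
  simp only [WeierstrassCurve.Affine.polynomial, map_add, map_sub, map_mul, map_pow, map_zero,
    zero_mul, add_zero] at h'
  have hA : algebraMap K (curve A B).FunctionField A = algebraMap (curve A B).CoordinateRing _
    (WeierstrassCurve.Affine.CoordinateRing.mk _ (Polynomial.C (Polynomial.C A))) := rfl
  have hB : algebraMap K (curve A B).FunctionField B = algebraMap (curve A B).CoordinateRing _
    (WeierstrassCurve.Affine.CoordinateRing.mk _ (Polynomial.C (Polynomial.C B))) := rfl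
  rw [hA, hB, xF, yF]
  linear_combination h'

lemma yF_ne_zero : yF A B ≠ 0 := by
  intro h
  have h1 : WeierstrassCurve.Affine.CoordinateRing.mk (curve A B) Polynomial.X = 0 :=
    (FaithfulSMul.algebraMap_injective (curve A B).CoordinateRing (curve A B).FunctionField)
      (by rw [map_zero]; exact h)
  have h2 := WeierstrassCurve.Affine.CoordinateRing.smul_basis_eq_zero (W' := curve A B)
    (p := 0) (q := 1) (by rw [zero_smul, zero_add, one_smul, h1])
  exact one_ne_zero h2.2

/-- There is a `K`-linear derivation of `K(E)` that maps `x` to `1`. -/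
lemma exists_derivation (h2 : (2 : K) ≠ 0) :
    ∃ δ : Derivation K (curve A B).FunctionField (curve A B).FunctionField, δ (xF A B) = 1 := by
  let F := (curve A B).FunctionField
  let a : F := algebraMap K F A
  let b : F := algebraMap K F B
  have h2F : (2 : F) ≠ 0 := by
    have := (map_ne_zero (algebraMap K F)).mpr h2
    rwa [map_ofNat] at this
  let m : F := (3 * xF A B ^ 2 + a) / (2 * yF A B)
  have hm : 2 * yF A B * m = 3 * xF A B ^ 2 + a :=
    mul_div_cancel₀ _ (mul_ne_zero h2F yF_ne_zero)
  let i : Polynomial K →+* F[ε] := Polynomial.eval₂RingHom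
    ((TrivSqZeroExt.inlHom F F).comp (algebraMap K F))
    (TrivSqZeroExt.inl (xF A B) + TrivSqZeroExt.inr 1)
  have hi : Polynomial.eval₂ i (TrivSqZeroExt.inl (yF A B) + TrivSqZeroExt.inr m)
      (curve A B).polynomial = 0 := by
    have hy := yF_sq (A := A) (B := B)
    simp only [WeierstrassCurve.Affine.polynomial, i, Polynomial.eval₂_add, Polynomial.eval₂_sub,
      Polynomial.eval₂_mul, Polynomial.eval₂_pow, Polynomial.eval₂_X, Polynomial.eval₂_C,
      Polynomial.coe_eval₂RingHom, Polynomial.eval₂_zero, Polynomial.C_0]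
    ext
    · simp [pow_succ]
      linear_combination hy
    · simp [pow_succ]
      linear_combination hm
  let φ : (curve A B).CoordinateRing →+* F[ε] := AdjoinRoot.lift i _ hi
  have hφ : (TrivSqZeroExt.fstHom F F F : F[ε] →+* F).comp φ = algebraMap _ F := by
    refine AdjoinRoot.ringHom_ext (Polynomial.ringHom_ext (fun c => ?_) ?_) ?_
    · simp [φ, i]
      rfl
    · simp [φ, i]
      rfl
    · simp [φ]
      rfl
  have hφ' (r) : (φ r).fst = algebraMap _ F r := congrArg (fun f => f r) hφ
  let ψ : F →+* F[ε] := IsLocalization.lift (M := nonZeroDivisors (curve A B).CoordinateRing)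
    (g := φ) (fun r => by
      rw [TrivSqZeroExt.isUnit_iff_isUnit_fst, hφ']
      exact IsLocalization.map_units F r)
  have hψφ (r) : ψ (algebraMap _ F r) = φ r := IsLocalization.lift_eq _ r
  have hψ (f : F) : (ψ f).fst = f := by
    have : (TrivSqZeroExt.fstHom F F F : F[ε] →+* F).comp ψ = RingHom.id F :=
      IsLocalization.ringHom_ext (nonZeroDivisors (curve A B).CoordinateRing) (by
        refine RingHom.ext fun r => ?_
        change (ψ (algebraMap _ F r)).fst = algebraMap _ F r
        rw [hψφ, hφ'])
    exact congrArg (fun g => g f) this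
  have hψK (c : K) : ψ (algebraMap K F c) = TrivSqZeroExt.inl (algebraMap K F c) := by
    have : algebraMap K F c = algebraMap (curve A B).CoordinateRing F
      (AdjoinRoot.of _ (Polynomial.C c)) := rfl
    rw [this, hψφ, ← this]
    simp [φ, i]
  refine ⟨Derivation.mk' ⟨⟨fun f => (ψ f).snd, ?_⟩, ?_⟩ ?_, ?_⟩
  · intro f g
    simp
  · intro c f
    change (ψ (c • f)).snd = c • (ψ f).snd
    rw [Algebra.smul_def, map_mul, hψK, Algebra.smul_def]
    simp
  · intro f g
    change (ψ (f * g)).snd = f • (ψ g).snd + g • (ψ f).snd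
    rw [map_mul, TrivSqZeroExt.snd_mul, hψ, hψ]
    simp [mul_comm]
  · change (ψ (xF A B)).snd = 1
    rw [xF, hψφ]
    simp [φ, i]

/-- There is only one such derivation. -/
lemma derivation_unique (h2 : (2 : K) ≠ 0)
    {δ₁ δ₂ : Derivation K (curve A B).FunctionField (curve A B).FunctionField}
    (h₁ : δ₁ (xF A B) = 1) (h₂ : δ₂ (xF A B) = 1) : δ₁ = δ₂ := by
  let F := (curve A B).FunctionField
  have h2F : (2 : F) ≠ 0 := by
    have := (map_ne_zero (algebraMap K F)).mpr h2
    rwa [map_ofNat] at this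
  suffices h : ∀ δ : Derivation K (curve A B).FunctionField (curve A B).FunctionField,
      δ (xF A B) = 0 → δ = 0 from
    sub_eq_zero.mp (h (δ₁ - δ₂) (by simp [h₁, h₂]))
  intro δ hx
  have hy : δ (yF A B) = 0 := by
    have h := congrArg δ (yF_sq (A := A) (B := B))
    simp only [map_add, Derivation.leibniz_pow, Derivation.leibniz, Derivation.map_algebraMap, hx,
      add_zero, nsmul_eq_mul, smul_eq_mul] at h
    simpa [h2F, yF_ne_zero] using h
  have hX (q : Polynomial K) : δ (algebraMap (curve A B).CoordinateRing F
      (AdjoinRoot.of (curve A B).polynomial q)) = 0 := by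
    induction q using Polynomial.induction_on' with
    | add q r hq hr => simp [hq, hr]
    | monomial n c =>
      have : algebraMap (curve A B).CoordinateRing F (AdjoinRoot.of (curve A B).polynomial
          (Polynomial.monomial n c)) = c • xF A B ^ n := by
        rw [← Polynomial.C_mul_X_pow_eq_monomial, map_mul, map_mul, map_pow, map_pow,
          Algebra.smul_def]
        rfl
      rw [this, Derivation.map_smul, Derivation.leibniz_pow, hx]
      simp
  have hR (r : (curve A B).CoordinateRing) : δ (algebraMap _ F r) = 0 := by
    induction r using AdjoinRoot.induction_on with
    | ih q =>
      induction q using Polynomial.induction_on' with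
      | add q r hq hr => simp [hq, hr]
      | monomial n c =>
        have : algebraMap (curve A B).CoordinateRing F (AdjoinRoot.mk (curve A B).polynomial
            (Polynomial.monomial n c)) = algebraMap (curve A B).CoordinateRing F
              (AdjoinRoot.of (curve A B).polynomial c) * yF A B ^ n := by
          rw [← Polynomial.C_mul_X_pow_eq_monomial, map_mul, map_mul, map_pow, map_pow]
          rfl
        rw [this, Derivation.leibniz, Derivation.leibniz_pow, hy, hX]
        simp
  ext f
  obtain ⟨r, s, hs, rfl⟩ := IsFractionRing.div_surjective (A := (curve A B).CoordinateRing) f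
  rw [div_eq_mul_inv, Derivation.leibniz, Derivation.leibniz_inv, hR, hR]
  simp

/-- Differentiation `d/dx` of functions on `E` (in characteristic other than two): the `K`-linear
derivation of `K(E)` that maps `x` to `1`. -/
noncomputable def ddx (A B : K) (h2 : (2 : K) ≠ 0) :
    Derivation K (curve A B).FunctionField (curve A B).FunctionField :=
  (exists_derivation h2).choose

/-- The function `g` is regular at the point `P` of `E` and has the value `c` there: it is a
quotient `N / D` of forms of the same degree in projective coordinates with `D(P) ≠ 0`, and
`N(P) / D(P) = c`. -/
def HasValueAt (g : (curve A B).FunctionField) (P : (curve A B).Point) (c : K) : Prop :=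
  ∃ (n : ℕ) (N D : MvPolynomial (Fin 3) K), N.IsHomogeneous n ∧ D.IsHomogeneous n ∧
    MvPolynomial.eval (coords P) D ≠ 0 ∧
    g * MvPolynomial.aeval ![xF A B, yF A B, 1] D = MvPolynomial.aeval ![xF A B, yF A B, 1] N ∧
    MvPolynomial.eval (coords P) N / MvPolynomial.eval (coords P) D = c

/-- `t` is a uniformizer at `P`: it generates the ideal of the functions that vanish at `P` in the
ring of the functions that are regular at `P`. -/
def IsUniformizerAt (t : (curve A B).FunctionField) (P : (curve A B).Point) : Prop :=
  HasValueAt t P 0 ∧ ∀ g, HasValueAt g P 0 → ∃ u c, HasValueAt u P c ∧ g = t * u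

/-- The function `f` is nonzero and has order `n` at `P`: it is `t ^ n * u` for a uniformizer `t`
and a function `u` that is regular and does not vanish at `P`. -/
def HasOrderAt (f : (curve A B).FunctionField) (P : (curve A B).Point) (n : ℤ) : Prop :=
  ∃ t u c, IsUniformizerAt t P ∧ HasValueAt u P c ∧ c ≠ 0 ∧ f = t ^ n * u

/-- The divisor of the function `f` is `D`. -/
def HasDivisor (f : (curve A B).FunctionField) (D : (curve A B).Point →₀ ℤ) : Prop :=
  ∀ P, HasOrderAt f P (D P)

end Functions

end DualPairing

open DualPairing

namespace DualPairing

/-! ### Forms and charts -/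

section Charts

variable {K : Type*} [Field K] {A B : K}

/-! Let δ = 2y d/dx (`invDer`), the translation-invariant derivation of K(E). Adding O_k to an
affine point moves it by the infinitesimal vector -kεδ, so for h regular and nonzero at W one has
h(O_k + W)/h(W) = 1 - k (δh/h)(W) ε. Translation by -T commutes with adding O_k
(`dualAdd_shift_liftPt`), so every factor of e is such a quotient at W = R - T. Since p is odd, pW =
-T ≠ O, whereas the zeros and poles of the untranslated functions h_{i,j} are p-torsion points.
Hence all factors are defined and invertible at W (`hNum_ne_zero`, `hDen_ne_zero`).

Factors in 1 + εK multiply by adding their ε-parts, and logarithmic derivatives of products add.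
Therefore e(P, O_k) = 1 - k (δf/f)(W) ε with f the product of the h_{i,j} over the chain. The
divisors of lines telescope along the chain, so div f = p(P) - p(O)
(`IsChainDecomposition.hasDivisor`).

Characteristic p now makes δf/f a constant. Locally f = t^{pn} u with u a unit, δ kills p-th powers,
and δ maps regular functions to regular functions, at infinity too. So δf/f = δu/u has no pole
(`HasOrderAt.exists_hasValueAt_invDer_div`) and is constant (`exists_eq_algebraMap_of_regular`). If
div f = pD and div f' = pD' with D, D' of the same degree and sum, then D - D' = div g and f/f' is a
constant times g^p, so the two logarithmic derivatives agree (`logDer_eq_of_sum_eq`).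

Thus e(P, O_k) = 1 - kcε, where c depends only on P (`pairing_infPt_eq`). This gives independence of
the chain, of R and of T; additivity in k is visible, additivity in P comes from multiplying
functions, and the p-th power is 1 - pkcε = 1. -/

/-- The coordinates `x, y, 1` in the affine coordinate ring. -/
noncomputable def ringCoords (A B : K) : Fin 3 → (curve A B).CoordinateRing :=
  ![WeierstrassCurve.Affine.CoordinateRing.mk _ (Polynomial.C Polynomial.X),
    WeierstrassCurve.Affine.CoordinateRing.mk _ Polynomial.X, 1]

/-- Coordinates on `E` as functions that are regular at the given point. -/
noncomputable def chart : (curve A B).Point → Fin 3 → (curve A B).FunctionField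
  | .zero => ![xF A B / yF A B, 1, 1 / yF A B]
  | .some _ _ _ => ![xF A B, yF A B, 1]

lemma algebraMap_ringCoords (N : MvPolynomial (Fin 3) K) :
    algebraMap _ (curve A B).FunctionField (MvPolynomial.aeval (ringCoords A B) N) =
      MvPolynomial.aeval ![xF A B, yF A B, 1] N := by
  rw [← MvPolynomial.aeval_algebraMap_apply]
  congr 2
  ext i
  fin_cases i <;> simp [ringCoords, xF, yF]

lemma aeval_smul_of_isHomogeneous {S : Type*} [CommRing S] [Algebra K S]
    {N : MvPolynomial (Fin 3) K} {n : ℕ} (hN : N.IsHomogeneous n) (u : S) (q : Fin 3 → S) :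
    MvPolynomial.aeval (u • q) N = u ^ n * MvPolynomial.aeval q N := by
  rw [MvPolynomial.aeval_def, MvPolynomial.eval₂_eq, MvPolynomial.aeval_def, MvPolynomial.eval₂_eq,
    Finset.mul_sum]
  refine Finset.sum_congr rfl fun d hd => ?_
  have := hN.degree_eq_sum_deg_support hd
  simp only [Pi.smul_apply, smul_eq_mul, mul_pow, Finset.prod_mul_distrib, Finset.prod_pow_eq_pow_sum]
  rw [this]
  ring

/-- Homogenization in the variable `X j`: each homogeneous component is padded with a power of `X
j`. The degree `n` is left free so that a numerator and a denominator can be brought to the same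
degree. -/
lemma exists_isHomogeneous (N : MvPolynomial (Fin 3) K) (j : Fin 3) {n : ℕ}
    (hn : N.totalDegree ≤ n) : ∃ N' : MvPolynomial (Fin 3) K, N'.IsHomogeneous n ∧
      MvPolynomial.aeval (Function.update MvPolynomial.X j (1 : MvPolynomial (Fin 3) K)) N' =
        MvPolynomial.aeval (Function.update MvPolynomial.X j (1 : MvPolynomial (Fin 3) K)) N := by
  refine ⟨∑ i ∈ Finset.range (n + 1), MvPolynomial.homogeneousComponent i N *
    MvPolynomial.X j ^ (n - i), ?_, ?_⟩
  · refine MvPolynomial.IsHomogeneous.sum _ _ _ fun i hi => ?_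
    have h := (MvPolynomial.homogeneousComponent_isHomogeneous i N).mul
      ((MvPolynomial.isHomogeneous_X K j).pow (n - i))
    have : i + 1 * (n - i) = n := by
      have := Finset.mem_range.mp hi
      omega
    rwa [this] at h
  · conv_rhs => rw [← MvPolynomial.sum_homogeneousComponent N]
    simp only [map_sum, map_mul, map_pow, MvPolynomial.aeval_X, Function.update_self, one_pow,
      mul_one]
    symm
    refine Finset.sum_subset (Finset.range_mono (by omega)) fun i _ hi => ?_
    rw [MvPolynomial.homogeneousComponent_eq_zero, map_zero]
    simpa using hi

lemma aeval_update_X {S : Type*} [CommRing S] [Algebra K S] {q : Fin 3 → S} {j : Fin 3}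
    (hq : q j = 1) (N : MvPolynomial (Fin 3) K) :
    MvPolynomial.aeval q (MvPolynomial.aeval
      (Function.update MvPolynomial.X j (1 : MvPolynomial (Fin 3) K)) N) =
      MvPolynomial.aeval q N := by
  rw [← AlgHom.comp_apply]
  congr 1
  refine MvPolynomial.algHom_ext fun i => ?_
  by_cases h : i = j
  · subst h; simp [hq]
  · simp [h]

lemma exists_chart_coord_eq_one (P : (curve A B).Point) :
    ∃ j, chart P j = 1 ∧ coords P j = 1 := by
  match P with
  | .zero => exact ⟨1, rfl, rfl⟩
  | .some _ _ _ => exact ⟨2, rfl, rfl⟩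

/-- Both triples represent the generic point of E, so quotients of forms of equal degree have the
same value on either. -/
lemma exists_smul_chart (P : (curve A B).Point) :
    ∃ u : (curve A B).FunctionField, u ≠ 0 ∧ ![xF A B, yF A B, 1] = u • chart P := by
  match P with
  | .zero =>
    refine ⟨yF A B, yF_ne_zero, ?_⟩
    have := yF_ne_zero (A := A) (B := B)
    ext i
    fin_cases i <;> simp [chart] <;> field_simp
  | .some _ _ _ => exact ⟨1, one_ne_zero, by simp [chart]⟩

/-! ### The order of the pole at infinity -/

open Polynomial in
-- The degree of the norm to K[X] serves as the pole order at infinity. For p + q y it is the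
-- maximum of 2 deg p and 2 deg q + 3, so the ultrametric inequality can be checked on p and q
-- separately.
lemma degree_norm_add_lt {r s : (curve A B).CoordinateRing} {n : WithBot ℕ}
    (hr : (Algebra.norm K[X] r).degree < n) (hs : (Algebra.norm K[X] s).degree < n) :
    (Algebra.norm K[X] (r + s)).degree < n := by
  obtain ⟨p, q, rfl⟩ := WeierstrassCurve.Affine.CoordinateRing.exists_smul_basis_eq r
  obtain ⟨p', q', rfl⟩ := WeierstrassCurve.Affine.CoordinateRing.exists_smul_basis_eq s
  have : p • 1 + q • WeierstrassCurve.Affine.CoordinateRing.mk (curve A B) X +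
      (p' • 1 + q' • WeierstrassCurve.Affine.CoordinateRing.mk (curve A B) X) =
      (p + p') • 1 + (q + q') • WeierstrassCurve.Affine.CoordinateRing.mk (curve A B) X := by
    simp only [add_smul]
    ring
  rw [this]
  rw [WeierstrassCurve.Affine.CoordinateRing.degree_norm_smul_basis] at *
  rw [max_lt_iff] at *
  constructor
  · rcases max_choice p.degree p'.degree with h | h
    · exact lt_of_le_of_lt (nsmul_le_nsmul_right ((degree_add_le _ _).trans h.le) 2) hr.1
    · exact lt_of_le_of_lt (nsmul_le_nsmul_right ((degree_add_le _ _).trans h.le) 2) hs.1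
  · rcases max_choice q.degree q'.degree with h | h
    · exact lt_of_le_of_lt (add_le_add_left
        (nsmul_le_nsmul_right ((degree_add_le _ _).trans h.le) 2) 3) hr.2
    · exact lt_of_le_of_lt (add_le_add_left
        (nsmul_le_nsmul_right ((degree_add_le _ _).trans h.le) 2) 3) hs.2

open Polynomial in
lemma degree_norm_zero :
    (Algebra.norm K[X] (0 : (curve A B).CoordinateRing)).degree = ⊥ := by
  have := WeierstrassCurve.Affine.CoordinateRing.degree_norm_smul_basis (W' := curve A B) 0 0
  simpa using this

open Polynomial in
lemma degree_norm_ringCoords (i : Fin 3) :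
    (Algebra.norm K[X] (ringCoords A B i)).degree = (![2, 3, 0] i : ℕ) := by
  have h0 := WeierstrassCurve.Affine.CoordinateRing.degree_norm_smul_basis (W' := curve A B) X 0
  have h1 := WeierstrassCurve.Affine.CoordinateRing.degree_norm_smul_basis (W' := curve A B) 0 1
  have h2 := WeierstrassCurve.Affine.CoordinateRing.degree_norm_smul_basis (W' := curve A B) 1 0
  rw [WeierstrassCurve.Affine.CoordinateRing.smul, WeierstrassCurve.Affine.CoordinateRing.smul]
    at h0 h1 h2
  fin_cases i
  · simp [ringCoords] at h0 ⊢
    rw [h0]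
  · simp [ringCoords] at h1 ⊢
    rw [h1]
  · simp [ringCoords]

open Polynomial in
lemma degree_norm_algebraMap {c : K} (hc : c ≠ 0) :
    (Algebra.norm K[X] (algebraMap K (curve A B).CoordinateRing c)).degree = 0 := by
  have h := WeierstrassCurve.Affine.CoordinateRing.degree_norm_smul_basis (W' := curve A B) (C c) 0
  rw [zero_smul, add_zero, WeierstrassCurve.Affine.CoordinateRing.smul, mul_one] at h
  change (Algebra.norm K[X] (WeierstrassCurve.Affine.CoordinateRing.mk (curve A B) (C (C c)))).degree
    = 0
  rw [h]
  simp [hc]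

open Polynomial in
lemma degree_norm_neg (r : (curve A B).CoordinateRing) :
    (Algebra.norm K[X] (-r)).degree = (Algebra.norm K[X] r).degree := by
  have : -r = algebraMap K _ (-1) * r := by simp
  rw [this, map_mul, degree_mul, degree_norm_algebraMap (by simp), zero_add]

open Polynomial in
-- The coordinates x, y, 1 have pole orders 2, 3, 0, so among the monomials of degree n only Y^n
-- reaches pole order 3n. Evaluation at (0:1:0) picks out exactly its coefficient.
lemma degree_norm_monomial_lt {d : Fin 3 →₀ ℕ} {n : ℕ} (c : K) (hd : ∑ i, d i = n) :
    (Algebra.norm K[X] (MvPolynomial.aeval (ringCoords A B) (MvPolynomial.monomial d c) -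
      algebraMap K _ (MvPolynomial.eval ![0, 1, 0] (MvPolynomial.monomial d c)) *
        ringCoords A B 1 ^ n)).degree < (3 * n : ℕ) := by
  rw [MvPolynomial.aeval_monomial, MvPolynomial.eval_monomial, Finsupp.prod_fintype _ _ (by simp),
    Finsupp.prod_fintype _ _ (by simp)]
  simp only [Fin.prod_univ_three, Fin.sum_univ_three] at *
  by_cases h : d 0 = 0 ∧ d 2 = 0
  · rw [h.1, h.2] at hd ⊢
    have : d 1 = n := by omega
    simp [this, ringCoords, degree_norm_zero]
    exact WithBot.bot_lt_coe (3 * n)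
  · have h0 : (![0, 1, 0] : Fin 3 → K) 0 ^ d 0 * (![0, 1, 0] : Fin 3 → K) 1 ^ d 1 *
        (![0, 1, 0] : Fin 3 → K) 2 ^ d 2 = 0 := by
      simp
      tauto
    rw [h0, mul_zero, RingHom.map_zero, zero_mul, sub_zero]
    by_cases hc : c = 0
    · simp [hc, degree_norm_zero]
      exact WithBot.bot_lt_coe (3 * n)
    · simp only [map_mul, map_pow, degree_mul, degree_pow, degree_norm_algebraMap hc,
        degree_norm_ringCoords]
      simp only [Matrix.cons_val, nsmul_eq_mul]
      have : 0 + (d 0 * 2 + d 1 * 3 + d 2 * 0) < 3 * n := by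
        omega
      exact_mod_cast this

open Polynomial in
lemma degree_norm_aeval_sub_lt {N : MvPolynomial (Fin 3) K} {n : ℕ} (hN : N.IsHomogeneous n) :
    (Algebra.norm K[X] (MvPolynomial.aeval (ringCoords A B) N -
      algebraMap K _ (MvPolynomial.eval ![0, 1, 0] N) * ringCoords A B 1 ^ n)).degree
        < (3 * n : ℕ) := by
  have h : ∀ s ⊆ N.support, (Algebra.norm K[X] (MvPolynomial.aeval (ringCoords A B)
      (∑ d ∈ s, MvPolynomial.monomial d (N.coeff d)) - algebraMap K _ (MvPolynomial.eval ![0, 1, 0]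
      (∑ d ∈ s, MvPolynomial.monomial d (N.coeff d))) * ringCoords A B 1 ^ n)).degree
        < (3 * n : ℕ) := by
    intro s
    induction s using Finset.induction_on with
    | empty => simp [degree_norm_zero]; exact WithBot.bot_lt_coe (3 * n)
    | insert d s hd ih =>
      intro hs
      rw [Finset.sum_insert hd]
      have h1 := ih ((Finset.subset_insert _ _).trans hs)
      have h2 := degree_norm_monomial_lt (A := A) (B := B) (N.coeff d) (d := d) (n := n) (by
        rw [hN.degree_eq_sum_deg_support (hs (Finset.mem_insert_self d s))]
        exact (Finset.sum_subset (Finset.subset_univ _) (by simp)).symm)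
      convert degree_norm_add_lt h2 h1 using 3
      simp only [map_add]
      ring
  have := h _ subset_rfl
  rwa [MvPolynomial.support_sum_monomial_coeff] at this

open Polynomial in
lemma degree_norm_aeval_lt {N : MvPolynomial (Fin 3) K} {n : ℕ} (hN : N.IsHomogeneous n) :
    (Algebra.norm K[X] (MvPolynomial.aeval (ringCoords A B) N)).degree < (3 * n + 1 : ℕ) := by
  rw [← sub_add_cancel (MvPolynomial.aeval (ringCoords A B) N)
    (algebraMap K _ (MvPolynomial.eval ![0, 1, 0] N) * ringCoords A B 1 ^ n)]
  refine degree_norm_add_lt ((degree_norm_aeval_sub_lt hN).trans (by exact_mod_cast Nat.lt_succ_self _)) ?_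
  by_cases hc : MvPolynomial.eval ![0, 1, 0] N = 0
  · rw [hc, map_zero, zero_mul, degree_norm_zero]
    exact WithBot.bot_lt_coe (3 * n + 1)
  · rw [map_mul, map_pow, degree_mul, degree_pow, degree_norm_algebraMap hc, degree_norm_ringCoords]
    simp only [Matrix.cons_val, zero_add, nsmul_eq_mul]
    have : n * 3 < 3 * n + 1 := by omega
    exact_mod_cast this

open Polynomial in
-- If the leading coefficient N(0:1:0) were nonzero, the term in y^n would have pole order exactly
-- 3n and nothing could cancel it. This replaces evaluation at O, which is not a point of the affine
-- coordinate ring.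
lemma eval_eq_zero_of_degree_norm_lt {N : MvPolynomial (Fin 3) K} {n : ℕ} (hN : N.IsHomogeneous n)
    (h : (Algebra.norm K[X] (MvPolynomial.aeval (ringCoords A B) N)).degree < (3 * n : ℕ)) :
    MvPolynomial.eval ![0, 1, 0] N = 0 := by
  by_contra hc
  have h1 := degree_norm_aeval_sub_lt (A := A) (B := B) hN
  rw [← degree_norm_neg] at h1
  have h2 := degree_norm_add_lt h h1
  rw [neg_sub, add_sub_cancel, map_mul, map_pow, degree_mul, degree_pow, degree_norm_algebraMap hc,
    degree_norm_ringCoords] at h2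
  simp only [Matrix.cons_val, zero_add, nsmul_eq_mul] at h2
  have : n * 3 < 3 * n := by exact_mod_cast h2
  omega

/-! ### Values of functions -/

/-- Evaluation of the affine coordinate ring at a point of the curve. -/
noncomputable def evalHom {x y : K} (h : (curve A B).Equation x y) :
    (curve A B).CoordinateRing →+* K :=
  AdjoinRoot.evalEval h

lemma evalHom_aeval {x y : K} (h : (curve A B).Equation x y) (N : MvPolynomial (Fin 3) K) :
    evalHom h (MvPolynomial.aeval (ringCoords A B) N) = MvPolynomial.eval ![x, y, 1] N := by
  have hK (c : K) : evalHom h (algebraMap K _ c) = c := by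
    change evalHom h (AdjoinRoot.of _ (Polynomial.C c)) = c
    simp [evalHom, AdjoinRoot.evalEval]
  induction N using MvPolynomial.induction_on with
  | C c => simp [hK]
  | add p q hp hq => simp [hp, hq]
  | mul_X p i hp =>
    rw [map_mul, map_mul, hp, map_mul, MvPolynomial.aeval_X, MvPolynomial.eval_X]
    congr 1
    fin_cases i <;> simp [ringCoords, evalHom, AdjoinRoot.evalEval]

end Charts

section Values

variable {K : Type*} [Field K] {A B : K}

lemma ringHomInjective : Function.Injective
    (algebraMap (curve A B).CoordinateRing (curve A B).FunctionField) :=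
  FaithfulSMul.algebraMap_injective _ _

lemma aeval_homogenization {S : Type*} [CommRing S] [Algebra K S] {q : Fin 3 → S} {j : Fin 3}
    (hq : q j = 1) {N N' : MvPolynomial (Fin 3) K}
    (h : MvPolynomial.aeval (Function.update MvPolynomial.X j (1 : MvPolynomial (Fin 3) K)) N' =
        MvPolynomial.aeval (Function.update MvPolynomial.X j (1 : MvPolynomial (Fin 3) K)) N) :
    MvPolynomial.aeval q N' = MvPolynomial.aeval q N := by
  rw [← aeval_update_X hq, h, aeval_update_X hq]

/-- This makes values of functions well defined. After homogenization the relation holds in the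
affine coordinate ring; an affine point is then a ring homomorphism to K, and the point O is handled
by the pole order. -/
lemma eval_eq_zero_of_aeval_chart {P : (curve A B).Point} {N : MvPolynomial (Fin 3) K}
    (hN : MvPolynomial.aeval (chart P) N = 0) : MvPolynomial.eval (coords P) N = 0 := by
  obtain ⟨j, hj, hj'⟩ := exists_chart_coord_eq_one P
  obtain ⟨N', hN', h⟩ := exists_isHomogeneous N j le_rfl
  obtain ⟨u, -, hu⟩ := exists_smul_chart P
  rw [← aeval_homogenization hj h] at hN
  have h1 := aeval_homogenization hj' h
  rw [MvPolynomial.aeval_eq_eval] at h1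
  have h0 : MvPolynomial.aeval (ringCoords A B) N' = 0 := by
    apply ringHomInjective
    rw [algebraMap_ringCoords, hu, aeval_smul_of_isHomogeneous hN', hN, mul_zero, map_zero]
  change _ = MvPolynomial.eval _ _ at h1
  rw [← h1]
  match P with
  | .zero =>
    refine eval_eq_zero_of_degree_norm_lt (A := A) (B := B) hN' ?_
    rw [h0, degree_norm_zero]
    exact WithBot.bot_lt_coe _
  | .some x y h =>
    have := evalHom_aeval h.1 N'
    rw [h0, map_zero] at this
    exact this.symm

lemma aeval_chart_ne_zero {P : (curve A B).Point} {N : MvPolynomial (Fin 3) K}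
    (hN : MvPolynomial.eval (coords P) N ≠ 0) : MvPolynomial.aeval (chart P) N ≠ 0 :=
  fun h => hN (eval_eq_zero_of_aeval_chart h)

/-- Homogeneity can be dropped once the coordinates are normalized near `P`: regular functions are
quotients of arbitrary polynomials in the chart coordinates. The closure properties below become
computations with fractions. -/
lemma hasValueAt_iff {g : (curve A B).FunctionField} {P : (curve A B).Point} {c : K} :
    HasValueAt g P c ↔ ∃ N D : MvPolynomial (Fin 3) K, MvPolynomial.eval (coords P) D ≠ 0 ∧
      g * MvPolynomial.aeval (chart P) D = MvPolynomial.aeval (chart P) N ∧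
      MvPolynomial.eval (coords P) N = c * MvPolynomial.eval (coords P) D := by
  obtain ⟨u, hu0, hu⟩ := exists_smul_chart P
  constructor
  · rintro ⟨n, N, D, hN, hD, hD0, hg, hc⟩
    refine ⟨N, D, hD0, ?_, by rw [← hc, div_mul_cancel₀ _ hD0]⟩
    rw [hu, aeval_smul_of_isHomogeneous hN, aeval_smul_of_isHomogeneous hD] at hg
    refine mul_left_cancel₀ (pow_ne_zero n hu0) ?_
    linear_combination hg
  · rintro ⟨N, D, hD0, hg, hc⟩
    obtain ⟨j, hj, hj'⟩ := exists_chart_coord_eq_one P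
    obtain ⟨N', hN', hNN⟩ := exists_isHomogeneous N j (le_max_left N.totalDegree D.totalDegree)
    obtain ⟨D', hD', hDD⟩ := exists_isHomogeneous D j (le_max_right N.totalDegree D.totalDegree)
    have h1 := aeval_homogenization hj' hNN
    have h2 := aeval_homogenization hj' hDD
    change MvPolynomial.eval _ _ = MvPolynomial.eval _ _ at h1 h2
    refine ⟨_, N', D', hN', hD', h2 ▸ hD0, ?_, ?_⟩
    · rw [hu, aeval_smul_of_isHomogeneous hN', aeval_smul_of_isHomogeneous hD',
        aeval_homogenization hj hNN, aeval_homogenization hj hDD, ← hg]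
      ring
    · rw [h1, h2, hc, mul_div_cancel_right₀ _ hD0]

namespace HasValueAt

variable {g h : (curve A B).FunctionField} {P : (curve A B).Point} {c d : K}

lemma aeval_chart (P : (curve A B).Point) (N : MvPolynomial (Fin 3) K) :
    HasValueAt (MvPolynomial.aeval (chart P) N) P (MvPolynomial.eval (coords P) N) :=
  hasValueAt_iff.mpr ⟨N, 1, by simp, by simp, by simp⟩

lemma const (P : (curve A B).Point) (c : K) :
    HasValueAt (algebraMap K (curve A B).FunctionField c) P c := by
  simpa using aeval_chart P (MvPolynomial.C c)

lemma zero (P : (curve A B).Point) : HasValueAt 0 P 0 := by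
  simpa using const P 0

lemma one (P : (curve A B).Point) : HasValueAt 1 P 1 := by
  simpa using const P 1

lemma add (hg : HasValueAt g P c) (hh : HasValueAt h P d) : HasValueAt (g + h) P (c + d) := by
  obtain ⟨N, D, hD, h1, h2⟩ := hasValueAt_iff.mp hg
  obtain ⟨N', D', hD', h1', h2'⟩ := hasValueAt_iff.mp hh
  refine hasValueAt_iff.mpr ⟨N * D' + N' * D, D * D', by simp [hD, hD'], ?_, ?_⟩
  · simp only [map_mul, map_add]
    linear_combination (MvPolynomial.aeval (chart P) D') * h1 + (MvPolynomial.aeval (chart P) D) * h1'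
  · simp only [map_mul, map_add, h2, h2']
    ring

lemma mul (hg : HasValueAt g P c) (hh : HasValueAt h P d) : HasValueAt (g * h) P (c * d) := by
  obtain ⟨N, D, hD, h1, h2⟩ := hasValueAt_iff.mp hg
  obtain ⟨N', D', hD', h1', h2'⟩ := hasValueAt_iff.mp hh
  refine hasValueAt_iff.mpr ⟨N * N', D * D', by simp [hD, hD'], ?_, ?_⟩
  · simp only [map_mul, ← h1, ← h1']
    ring
  · simp only [map_mul, h2, h2']
    ring

lemma neg (hg : HasValueAt g P c) : HasValueAt (-g) P (-c) := by
  simpa using (const P (-1)).mul hg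

lemma sub (hg : HasValueAt g P c) (hh : HasValueAt h P d) : HasValueAt (g - h) P (c - d) := by
  simpa [sub_eq_add_neg] using hg.add hh.neg

lemma pow (hg : HasValueAt g P c) (n : ℕ) : HasValueAt (g ^ n) P (c ^ n) := by
  induction n with
  | zero => simpa using one P
  | succ n ih => simpa only [pow_succ] using ih.mul hg

lemma unique (hg : HasValueAt g P c) (hg' : HasValueAt g P d) : c = d := by
  obtain ⟨N, D, hD, h1, h2⟩ := hasValueAt_iff.mp hg
  obtain ⟨N', D', hD', h1', h2'⟩ := hasValueAt_iff.mp hg'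
  have h : MvPolynomial.aeval (chart P) (N * D' - N' * D) = 0 := by
    simp only [map_mul, map_sub, ← h1, ← h1']
    ring
  have := eval_eq_zero_of_aeval_chart h
  simp only [map_mul, map_sub, h2, h2'] at this
  have h3 : (c - d) * (MvPolynomial.eval (coords P) D * MvPolynomial.eval (coords P) D') = 0 := by
    linear_combination this
  simpa [hD, hD', sub_eq_zero] using h3

lemma ne_zero (hg : HasValueAt g P c) (hc : c ≠ 0) : g ≠ 0 := by
  rintro rfl
  exact hc (hg.unique (zero P))

lemma inv (hg : HasValueAt g P c) (hc : c ≠ 0) : HasValueAt g⁻¹ P c⁻¹ := by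
  have h0 := hg.ne_zero hc
  obtain ⟨N, D, hD, h1, h2⟩ := hasValueAt_iff.mp hg
  refine hasValueAt_iff.mpr ⟨D, N, by simp [h2, hc, hD], by rw [← h1, inv_mul_cancel_left₀ h0], ?_⟩
  rw [h2, inv_mul_cancel_left₀ hc]

lemma div (hg : HasValueAt g P c) (hh : HasValueAt h P d) (hd : d ≠ 0) :
    HasValueAt (g / h) P (c / d) := by
  simpa only [div_eq_mul_inv] using hg.mul (hh.inv hd)

lemma zpow (hg : HasValueAt g P c) (hc : c ≠ 0) (n : ℤ) : HasValueAt (g ^ n) P (c ^ n) := by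
  cases n with
  | ofNat n => simpa using hg.pow n
  | negSucc n => simpa only [zpow_negSucc] using (hg.pow (n + 1)).inv (pow_ne_zero _ hc)

lemma chart_apply (P : (curve A B).Point) (i : Fin 3) : HasValueAt (chart P i) P (coords P i) := by
  simpa using aeval_chart P (MvPolynomial.X i)

end HasValueAt

/-! ### The invariant derivation -/

lemma ddx_xF (h2 : (2 : K) ≠ 0) : ddx A B h2 (xF A B) = 1 :=
  (exists_derivation h2).choose_spec

lemma two_ne_zero_functionField (h2 : (2 : K) ≠ 0) : (2 : (curve A B).FunctionField) ≠ 0 := by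
  have := (map_ne_zero (algebraMap K (curve A B).FunctionField)).mpr h2
  rwa [map_ofNat] at this

/-- The derivation `2 y d/dx`, which is invariant under translations. -/
noncomputable def invDer (A B : K) (h2 : (2 : K) ≠ 0) :
    Derivation K (curve A B).FunctionField (curve A B).FunctionField :=
  (2 * yF A B) • ddx A B h2

lemma invDer_apply (h2 : (2 : K) ≠ 0) (g : (curve A B).FunctionField) :
    invDer A B h2 g = 2 * yF A B * ddx A B h2 g := rfl

lemma invDer_xF (h2 : (2 : K) ≠ 0) : invDer A B h2 (xF A B) = 2 * yF A B := by
  rw [invDer_apply, ddx_xF, mul_one]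

lemma invDer_yF (h2 : (2 : K) ≠ 0) :
    invDer A B h2 (yF A B) = 3 * xF A B ^ 2 + algebraMap K _ A := by
  have h := congrArg (invDer A B h2) (yF_sq (A := A) (B := B))
  simp only [map_add, Derivation.leibniz_pow, Derivation.leibniz, Derivation.map_algebraMap,
    invDer_xF, nsmul_eq_mul, smul_eq_mul] at h
  have h0 := mul_ne_zero (two_ne_zero_functionField h2) (yF_ne_zero (A := A) (B := B))
  refine mul_left_cancel₀ h0 ?_
  push_cast at h
  simp only [pow_one] at h
  linear_combination h

/-- The derivation 2y d/dx has no poles, not even at infinity: it preserves the polynomials in the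
local coordinates of each chart. -/
lemma exists_invDer_chart (h2 : (2 : K) ≠ 0) (P : (curve A B).Point) (i : Fin 3) :
    ∃ M : MvPolynomial (Fin 3) K, invDer A B h2 (chart P i) = MvPolynomial.aeval (chart P) M := by
  match P with
  | .zero =>
    have hy := yF_ne_zero (A := A) (B := B)
    have he := yF_sq (A := A) (B := B)
    fin_cases i
    -- The derivative of x/y is 2 - (3x³ + Ax)/y²; replacing x³ by y² - Ax - B leaves a polynomial
    -- in x/y and 1/y.
    · refine ⟨-1 + 2 * MvPolynomial.C A * MvPolynomial.X 0 * MvPolynomial.X 2 +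
        3 * MvPolynomial.C B * MvPolynomial.X 2 ^ 2, ?_⟩
      simp [chart, div_eq_mul_inv, Derivation.leibniz_inv, invDer_xF, invDer_yF]
      field_simp
      linear_combination 3 * he
    · exact ⟨0, by simp [chart]⟩
    · refine ⟨- (3 * MvPolynomial.X 0 ^ 2 + MvPolynomial.C A * MvPolynomial.X 2 ^ 2), ?_⟩
      simp [chart, Derivation.leibniz_inv, invDer_yF]
      field_simp
      ring
  | .some x y h =>
    fin_cases i
    · exact ⟨2 * MvPolynomial.X 1, by simp [chart, invDer_xF]⟩
    · exact ⟨3 * MvPolynomial.X 0 ^ 2 + MvPolynomial.C A, by simp [chart, invDer_yF]⟩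
    · exact ⟨0, by simp [chart]⟩

lemma exists_invDer_aeval_chart (h2 : (2 : K) ≠ 0) (P : (curve A B).Point)
    (N : MvPolynomial (Fin 3) K) : ∃ M : MvPolynomial (Fin 3) K,
      invDer A B h2 (MvPolynomial.aeval (chart P) N) = MvPolynomial.aeval (chart P) M := by
  induction N using MvPolynomial.induction_on with
  | C c => exact ⟨0, by simp⟩
  | add p q hp hq =>
    obtain ⟨M, hM⟩ := hp
    obtain ⟨M', hM'⟩ := hq
    exact ⟨M + M', by simp [hM, hM']⟩
  | mul_X p i hp =>
    obtain ⟨M, hM⟩ := hp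
    obtain ⟨M', hM'⟩ := exists_invDer_chart h2 P i
    exact ⟨p * M' + MvPolynomial.X i * M, by simp [hM, hM']⟩

/-- By the quotient rule, a derivation that preserves the polynomials in the chart also preserves
the local ring at `P`. -/
lemma HasValueAt.exists_invDer (h2 : (2 : K) ≠ 0) {g : (curve A B).FunctionField}
    {P : (curve A B).Point} {c : K} (hg : HasValueAt g P c) :
    ∃ d, HasValueAt (invDer A B h2 g) P d := by
  obtain ⟨N, D, hD, h1, -⟩ := hasValueAt_iff.mp hg
  obtain ⟨N', hN'⟩ := exists_invDer_aeval_chart h2 P N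
  obtain ⟨D', hD'⟩ := exists_invDer_aeval_chart h2 P D
  have h := congrArg (invDer A B h2) h1
  rw [Derivation.leibniz, hN', hD', smul_eq_mul, smul_eq_mul] at h
  have h0 := aeval_chart_ne_zero hD
  have : invDer A B h2 g = (MvPolynomial.aeval (chart P) N' - g * MvPolynomial.aeval (chart P) D') /
      MvPolynomial.aeval (chart P) D := by
    rw [eq_div_iff h0]
    linear_combination h
  rw [this]
  exact ⟨_, ((HasValueAt.aeval_chart P N').sub (hg.mul (.aeval_chart P D'))).div
    (.aeval_chart P D) hD⟩

end Values

/-! ### Functions regular everywhere are constant -/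

section Liouville

variable {K : Type*} [Field K] {A B : K}

lemma nonsingular_of_equation (h2 : (2 : K) ≠ 0) (hE : 4 * A ^ 3 + 27 * B ^ 2 ≠ 0) {x y : K}
    (h : (curve A B).Equation x y) : (curve A B).Nonsingular x y := by
  refine (WeierstrassCurve.Affine.equation_iff_nonsingular_of_Δ_ne_zero ?_).mp h
  have : (curve A B).Δ = -2 ^ 4 * (4 * A ^ 3 + 27 * B ^ 2) := by
    simp [WeierstrassCurve.Δ, WeierstrassCurve.b₂, WeierstrassCurve.b₄, WeierstrassCurve.b₆,
      WeierstrassCurve.b₈]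
    ring
  rw [this]
  exact mul_ne_zero (neg_ne_zero.mpr (pow_ne_zero _ h2)) hE

lemma equation_curve_iff {S : Type*} [CommRing S] {a b x y : S} :
    (curve a b).Equation x y ↔ y ^ 2 = x ^ 3 + a * x + b := by
  rw [WeierstrassCurve.Affine.equation_iff]
  simp

lemma ringCoords_equation : ringCoords A B 1 ^ 2 = ringCoords A B 0 ^ 3 +
    algebraMap K _ A * ringCoords A B 0 + algebraMap K _ B := by
  apply ringHomInjective
  simp only [map_add, map_mul, map_pow]
  exact yF_sq

lemma algHom_aeval_ringCoords {S : Type*} [CommRing S] [Algebra K S]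
    (φ : (curve A B).CoordinateRing →ₐ[K] S) (N : MvPolynomial (Fin 3) K) :
    φ (MvPolynomial.aeval (ringCoords A B) N) =
      MvPolynomial.aeval ![φ (ringCoords A B 0), φ (ringCoords A B 1), 1] N := by
  rw [← AlgHom.comp_apply]
  congr 1
  refine MvPolynomial.algHom_ext fun i => ?_
  fin_cases i <;> simp
  simp [ringCoords]

open Polynomial in
instance : Algebra.FiniteType K (curve A B).CoordinateRing :=
  have : Module.Finite K[X] (curve A B).CoordinateRing :=
    .of_basis (WeierstrassCurve.Affine.CoordinateRing.basis (curve A B))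
  Algebra.FiniteType.trans (S := K[X]) inferInstance inferInstance

/-- A function that is regular at all affine points lies in the affine coordinate ring. -/
lemma exists_algebraMap_eq_of_regular [IsAlgClosed K] (h2 : (2 : K) ≠ 0)
    (hE : 4 * A ^ 3 + 27 * B ^ 2 ≠ 0) {g : (curve A B).FunctionField}
    (hg : ∀ P, ∃ c, HasValueAt g P c) : ∃ r, algebraMap (curve A B).CoordinateRing _ r = g := by
  -- The ideal of denominators of `g`: all `r` such that `r * g` lies in the coordinate ring. The
  -- claim is that it contains 1.
  let I : Ideal (curve A B).CoordinateRing :=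
    (1 : Submodule (curve A B).CoordinateRing (curve A B).FunctionField).comap
      (LinearMap.toSpanSingleton _ _ g)
  have hI (r) : r ∈ I ↔ ∃ s, algebraMap (curve A B).CoordinateRing _ s =
      algebraMap (curve A B).CoordinateRing _ r * g := by
    rw [Submodule.mem_comap, LinearMap.toSpanSingleton_apply, Submodule.mem_one, Algebra.smul_def]
  by_cases hI1 : I = ⊤
  · obtain ⟨r, hr⟩ := (hI 1).mp (hI1 ▸ Submodule.mem_top)
    exact ⟨r, by simpa using hr⟩
  obtain ⟨m, hm, hIm⟩ := Ideal.exists_le_maximal I hI1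
  exfalso
  let := Ideal.Quotient.field m
  -- By the Nullstellensatz the residue field is K, so `m` is the ideal of a point (x, y). A
  -- denominator of `g` that does not vanish at that point lies in `I`, hence in `m`, a
  -- contradiction.
  have : Module.Finite K ((curve A B).CoordinateRing ⧸ m) :=
    finite_of_finite_type_of_isJacobsonRing K _
  have hbij := IsAlgClosed.algebraMap_bijective_of_isIntegral (k := K)
    (K := (curve A B).CoordinateRing ⧸ m)
  let φ := Ideal.Quotient.mkₐ K m
  obtain ⟨x, hx⟩ := hbij.2 (φ (ringCoords A B 0))
  obtain ⟨y, hy⟩ := hbij.2 (φ (ringCoords A B 1))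
  have hxy : (curve A B).Equation x y := by
    rw [equation_curve_iff]
    apply hbij.1
    have := congrArg φ (ringCoords_equation (A := A) (B := B))
    simp only [map_add, map_mul, map_pow, AlgHom.commutes] at this
    simp only [map_add, map_mul, map_pow, hx, hy, this]
  obtain ⟨c, n, N, D, hN, hD, hD0, h, -⟩ :=
    hg (.some x y (nonsingular_of_equation h2 hE hxy))
  refine hD0 ?_
  have hDm : MvPolynomial.aeval (ringCoords A B) D ∈ m := by
    refine hIm ((hI _).mpr ⟨MvPolynomial.aeval (ringCoords A B) N, ?_⟩)
    rw [algebraMap_ringCoords, algebraMap_ringCoords, ← h, mul_comm]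
  have h0 : φ (MvPolynomial.aeval (ringCoords A B) D) = 0 := Ideal.Quotient.eq_zero_iff_mem.mpr hDm
  rw [algHom_aeval_ringCoords, ← hx, ← hy] at h0
  apply hbij.1
  rw [map_zero, ← h0]
  change _ = MvPolynomial.aeval _ D
  have := MvPolynomial.aeval_algebraMap_apply ((curve A B).CoordinateRing ⧸ m) ![x, y, 1] D
  change algebraMap K _ (MvPolynomial.aeval _ D) = _
  refine Eq.trans this.symm ?_
  congr 2
  ext i
  fin_cases i <;> simp

/-- A function without poles is constant. -/
theorem exists_eq_algebraMap_of_regular [IsAlgClosed K] (h2 : (2 : K) ≠ 0)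
    (hE : 4 * A ^ 3 + 27 * B ^ 2 ≠ 0) {g : (curve A B).FunctionField}
    (hg : ∀ P, ∃ c, HasValueAt g P c) : ∃ c, g = algebraMap K _ c := by
  obtain ⟨r, rfl⟩ := exists_algebraMap_eq_of_regular h2 hE hg
  obtain ⟨c, n, N, D, hN, hD, hD0, h, -⟩ := hg .zero
  have h : r * MvPolynomial.aeval (ringCoords A B) D = MvPolynomial.aeval (ringCoords A B) N := by
    apply ringHomInjective
    rw [map_mul, algebraMap_ringCoords, algebraMap_ringCoords, h]
  have h1 := degree_norm_aeval_lt (A := A) (B := B) hN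
  have h3 := mt (eval_eq_zero_of_degree_norm_lt (A := A) (B := B) hD) hD0
  rw [← h, map_mul, Polynomial.degree_mul] at h1
  -- In r D = N the form D does not vanish at O, so D has pole order at least 3n, while N has at
  -- most 3n. Nothing is left for r.
  have h4 : (Algebra.norm (Polynomial K) r).degree ≤ 0 := by
    by_contra h4
    rw [not_le] at h4
    rw [not_lt] at h3
    refine absurd h1 (not_lt.mpr ?_)
    have := add_le_add (Order.succ_le_of_lt h4) h3
    refine le_trans (le_of_eq ?_) this
    rw [Nat.cast_add, add_comm]
    rfl
  obtain ⟨a, b, rfl⟩ := WeierstrassCurve.Affine.CoordinateRing.exists_smul_basis_eq r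
  rw [WeierstrassCurve.Affine.CoordinateRing.degree_norm_smul_basis, max_le_iff] at h4
  -- In r = a + b y, a nonzero b would contribute pole order at least 3.
  have hb : b = 0 := by
    by_contra hb
    rw [Polynomial.degree_eq_natDegree hb] at h4
    simp only [nsmul_eq_mul] at h4
    have : 2 * b.natDegree + 3 ≤ 0 := by exact_mod_cast h4.2
    omega
  have ha : a.degree ≤ 0 := by
    by_contra ha
    rw [not_le] at ha
    refine absurd h4.1 (not_le.mpr ?_)
    have ha0 : a ≠ 0 := by
      rintro rfl
      simp at ha
    rw [Polynomial.degree_eq_natDegree ha0] at ha ⊢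
    have : 0 < a.natDegree := by exact_mod_cast ha
    rw [nsmul_eq_mul]
    have : 0 < 2 * a.natDegree := by omega
    exact_mod_cast this
  rw [Polynomial.eq_C_of_degree_le_zero ha, hb, zero_smul, add_zero,
    WeierstrassCurve.Affine.CoordinateRing.smul, mul_one]
  exact ⟨a.coeff 0, rfl⟩

end Liouville

/-! ### Orders of functions -/

section Order

variable {K : Type*} [Field K] {A B : K}

/-- The maximal ideal at `P` is generated by the differences between the chart coordinates and their
values, by induction on polynomials. It suffices that `t` divides these differences. -/
lemma isUniformizerAt_of_chart {t : (curve A B).FunctionField} {P : (curve A B).Point}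
    (ht : HasValueAt t P 0)
    (h : ∀ i, ∃ u c, HasValueAt u P c ∧ chart P i - algebraMap K _ (coords P i) = t * u) :
    IsUniformizerAt t P := by
  have key (N : MvPolynomial (Fin 3) K) : ∃ u c, HasValueAt u P c ∧
      MvPolynomial.aeval (chart P) N - algebraMap K _ (MvPolynomial.eval (coords P) N) = t * u := by
    induction N using MvPolynomial.induction_on with
    | C c => exact ⟨0, 0, .zero P, by simp⟩
    | add p q hp hq =>
      obtain ⟨u, c, hu, hp⟩ := hp
      obtain ⟨v, d, hv, hq⟩ := hq
      refine ⟨u + v, _, hu.add hv, ?_⟩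
      simp only [map_add, mul_add, ← hp, ← hq]
      ring
    | mul_X p i hp =>
      obtain ⟨u, c, hu, hp⟩ := hp
      obtain ⟨v, d, hv, hi⟩ := h i
      refine ⟨u * chart P i + algebraMap K _ (MvPolynomial.eval (coords P) p) * v, _,
        (hu.mul (.chart_apply P i)).add ((HasValueAt.const P _).mul hv), ?_⟩
      simp only [map_mul, MvPolynomial.aeval_X, MvPolynomial.eval_X]
      linear_combination chart P i * hp + algebraMap K _ (MvPolynomial.eval (coords P) p) * hi
  refine ⟨ht, fun g hg => ?_⟩
  obtain ⟨N, D, hD, h1, h3⟩ := hasValueAt_iff.mp hg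
  obtain ⟨u, c, hu, hN⟩ := key N
  rw [h3, zero_mul, map_zero, sub_zero, ← h1] at hN
  refine ⟨u / MvPolynomial.aeval (chart P) D, _, hu.div (.aeval_chart P D) hD, ?_⟩
  rw [← mul_div_assoc, eq_div_iff (aeval_chart_ne_zero hD), hN]

lemma HasValueAt.xF {x y : K} (h : (curve A B).Nonsingular x y) : HasValueAt (xF A B) (.some x y h) x :=
  HasValueAt.chart_apply (.some x y h) 0

lemma HasValueAt.yF {x y : K} (h : (curve A B).Nonsingular x y) : HasValueAt (yF A B) (.some x y h) y :=
  HasValueAt.chart_apply (.some x y h) 1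

lemma HasValueAt.xF_div_yF : HasValueAt (DualPairing.xF A B / DualPairing.yF A B) .zero 0 :=
  HasValueAt.chart_apply .zero 0

lemma HasValueAt.inv_yF : HasValueAt (1 / DualPairing.yF A B) .zero 0 :=
  HasValueAt.chart_apply .zero 2

lemma xF_sub_ne_zero (h2 : (2 : K) ≠ 0) (c : K) : xF A B - algebraMap K _ c ≠ 0 := by
  intro h
  have := congrArg (ddx A B h2) h
  simp [ddx_xF] at this

/-- At infinity, `1 / y` is `(x / y) ^ 3` times a unit. -/
lemma exists_inv_yF_eq : ∃ u : (curve A B).FunctionField, HasValueAt u .zero 1 ∧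
    1 / yF A B = (xF A B / yF A B) ^ 3 * u := by
  -- Dividing the equation by y³ gives (1/y)(1 - A(x/y)(1/y) - B(1/y)²) = (x/y)³; the bracket has
  -- the value 1 at O, and `u` is its inverse.
  have hv := (((HasValueAt.one (A := A) (B := B) .zero).sub (((HasValueAt.const .zero A).mul
    HasValueAt.xF_div_yF).mul HasValueAt.inv_yF)).sub
      ((HasValueAt.const .zero B).mul (HasValueAt.inv_yF.pow 2)))
  have hv0 := hv.ne_zero (by simp)
  have hu := hv.inv (by simp)
  rw [show (1 - A * 0 * 0 - B * 0 ^ 2)⁻¹ = 1 by simp] at hu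
  refine ⟨_, hu, ?_⟩
  have hy := yF_ne_zero (A := A) (B := B)
  rw [eq_mul_inv_iff_mul_eq₀ hv0]
  field_simp
  linear_combination yF_sq (A := A) (B := B)

lemma isUniformizerAt_zero : IsUniformizerAt (xF A B / yF A B) .zero := by
  refine isUniformizerAt_of_chart HasValueAt.xF_div_yF fun i => ?_
  fin_cases i
  · exact ⟨1, 1, .one _, by simp [chart, coords]⟩
  · exact ⟨0, 0, .zero _, by simp [chart, coords]⟩
  · obtain ⟨u, hu, h⟩ := exists_inv_yF_eq (A := A) (B := B)
    refine ⟨_, _, (HasValueAt.xF_div_yF.pow 2).mul hu, ?_⟩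
    simp only [chart, coords, Fin.reduceFinMk, Matrix.cons_val, map_zero, sub_zero]
    rw [h]
    ring

lemma isUniformizerAt_of_Y_ne_zero (h2 : (2 : K) ≠ 0) {x y : K} (h : (curve A B).Nonsingular x y)
    (hy : y ≠ 0) : IsUniformizerAt (xF A B - algebraMap K _ x) (.some x y h) := by
  refine isUniformizerAt_of_chart (by simpa using (HasValueAt.xF h).sub (.const _ x)) fun i => ?_
  fin_cases i
  · exact ⟨1, 1, .one _, by simp [chart, coords]⟩
  · have hx := HasValueAt.xF h
    have hc := HasValueAt.const (.some x y h) x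
    have hv := (HasValueAt.yF h).add (.const _ y)
    have hv' : y + y ≠ 0 := by rw [← two_mul]; exact mul_ne_zero h2 hy
    -- Subtracting the equation at the point gives (y - y₀)(y + y₀) = (x - x₀)(x² + x x₀ + x₀² + A),
    -- and y + y₀ has the value 2y₀ ≠ 0.
    refine ⟨_, _, ((((hx.pow 2).add (hx.mul hc)).add (hc.pow 2)).add (.const _ A)).div hv hv', ?_⟩
    rw [← mul_div_assoc, eq_div_iff (hv.ne_zero hv')]
    simp only [chart, coords, Fin.reduceFinMk, Matrix.cons_val]
    have he := congrArg (algebraMap K (curve A B).FunctionField) (equation_curve_iff.mp h.1)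
    simp only [map_add, map_mul, map_pow] at he
    linear_combination yF_sq (A := A) (B := B) - he
  · exact ⟨0, 0, .zero _, by simp [chart, coords]⟩

lemma three_mul_sq_add_ne_zero {x : K} (h : (curve A B).Nonsingular x 0) : 3 * x ^ 2 + A ≠ 0 := by
  intro h0
  rcases ((WeierstrassCurve.Affine.nonsingular_iff' _ _).mp h).2 with h' | h'
  · refine h' ?_
    change (0 : K) * 0 - (3 * x ^ 2 + 2 * 0 * x + A) = 0
    linear_combination -h0
  · exact h' (by simp)

/-- At a point of order two, y² is x - x₀ times a function with the value 3x₀² + A, which is nonzero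
by nonsingularity. So x - x₀ has a double zero there and y is a uniformizer. -/
lemma exists_xF_sub_eq {x : K} (h : (curve A B).Nonsingular x 0) :
    ∃ u c, HasValueAt u (.some x 0 h) c ∧ c ≠ 0 ∧ xF A B - algebraMap K _ x = yF A B ^ 2 * u := by
  have hx := HasValueAt.xF h
  have hc := HasValueAt.const (.some x 0 h) x
  have hv := (((hx.pow 2).add (hx.mul hc)).add (hc.pow 2)).add (.const _ A)
  have hv' : x ^ 2 + x * x + x ^ 2 + A ≠ 0 := by
    convert three_mul_sq_add_ne_zero h using 1
    ring
  refine ⟨_, _, hv.inv hv', inv_ne_zero hv', ?_⟩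
  rw [eq_mul_inv_iff_mul_eq₀ (hv.ne_zero hv')]
  have he := congrArg (algebraMap K (curve A B).FunctionField) (equation_curve_iff.mp h.1)
  simp only [map_add, map_mul, map_pow, map_zero] at he
  linear_combination -yF_sq (A := A) (B := B) + he

lemma isUniformizerAt_of_Y_eq_zero {x : K} (h : (curve A B).Nonsingular x 0) :
    IsUniformizerAt (yF A B) (.some x 0 h) := by
  refine isUniformizerAt_of_chart (.yF h) fun i => ?_
  fin_cases i
  · obtain ⟨u, c, hu, -, he⟩ := exists_xF_sub_eq h
    exact ⟨_, _, (HasValueAt.yF h).mul hu, by simp [chart, coords, he, pow_two, mul_assoc]⟩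
  · exact ⟨1, 1, .one _, by simp [chart, coords]⟩
  · exact ⟨0, 0, .zero _, by simp [chart, coords]⟩

lemma xF_ne_zero (h2 : (2 : K) ≠ 0) : xF A B ≠ 0 := by
  simpa using xF_sub_ne_zero (A := A) (B := B) h2 0

lemma exists_isUniformizerAt (h2 : (2 : K) ≠ 0) (P : (curve A B).Point) :
    ∃ t, IsUniformizerAt t P ∧ t ≠ 0 := by
  match P with
  | .zero => exact ⟨_, isUniformizerAt_zero, div_ne_zero (xF_ne_zero h2) yF_ne_zero⟩
  | .some x y h =>
    by_cases hy : y = 0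
    · subst hy
      exact ⟨_, isUniformizerAt_of_Y_eq_zero h, yF_ne_zero⟩
    · exact ⟨_, isUniformizerAt_of_Y_ne_zero h2 h hy, xF_sub_ne_zero h2 x⟩

variable {P : (curve A B).Point} {t t' f g : (curve A B).FunctionField} {m n : ℤ} {c : K}

lemma IsUniformizerAt.ne_zero (h2 : (2 : K) ≠ 0) (ht : IsUniformizerAt t P) : t ≠ 0 := by
  obtain ⟨s, hs, hs0⟩ := exists_isUniformizerAt h2 P
  obtain ⟨u, c, -, h⟩ := ht.2 s hs.1
  rintro rfl
  exact hs0 (by simpa using h)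

lemma IsUniformizerAt.exists_eq_mul (h2 : (2 : K) ≠ 0) (ht : IsUniformizerAt t P)
    (ht' : IsUniformizerAt t' P) : ∃ u c, HasValueAt u P c ∧ c ≠ 0 ∧ t' = t * u := by
  obtain ⟨u, c, hu, h⟩ := ht.2 t' ht'.1
  obtain ⟨v, d, hv, h'⟩ := ht'.2 t ht.1
  refine ⟨u, c, hu, ?_, h⟩
  have h1 : u * v = 1 := by
    rw [h, mul_assoc] at h'
    exact mul_left_cancel₀ (ht.ne_zero h2) (by rw [← h', mul_one])
  have := hu.mul hv
  rw [h1] at this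
  exact left_ne_zero_of_mul ((this.unique (.one P)).trans_ne one_ne_zero)

lemma HasOrderAt.exists_eq (h2 : (2 : K) ≠ 0) (hf : HasOrderAt f P n) (ht : IsUniformizerAt t P) :
    ∃ u c, HasValueAt u P c ∧ c ≠ 0 ∧ f = t ^ n * u := by
  obtain ⟨t', u, c, ht', hu, hc, rfl⟩ := hf
  obtain ⟨v, d, hv, hd, rfl⟩ := ht.exists_eq_mul h2 ht'
  exact ⟨_, _, (hv.zpow hd n).mul hu, mul_ne_zero (zpow_ne_zero n hd) hc, by rw [mul_zpow, mul_assoc]⟩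

lemma HasOrderAt.ne_zero (h2 : (2 : K) ≠ 0) (hf : HasOrderAt f P n) : f ≠ 0 := by
  obtain ⟨t, u, c, ht, hu, hc, rfl⟩ := hf
  exact mul_ne_zero (zpow_ne_zero n (ht.ne_zero h2)) (hu.ne_zero hc)

lemma HasOrderAt.mul (h2 : (2 : K) ≠ 0) (hf : HasOrderAt f P m) (hg : HasOrderAt g P n) :
    HasOrderAt (f * g) P (m + n) := by
  obtain ⟨t, u, c, ht, hu, hc, rfl⟩ := hf
  obtain ⟨v, d, hv, hd, rfl⟩ := hg.exists_eq h2 ht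
  refine ⟨t, u * v, c * d, ht, hu.mul hv, mul_ne_zero hc hd, ?_⟩
  rw [zpow_add₀ (ht.ne_zero h2)]
  ring

lemma HasOrderAt.inv (hf : HasOrderAt f P m) : HasOrderAt f⁻¹ P (-m) := by
  obtain ⟨t, u, c, ht, hu, hc, rfl⟩ := hf
  exact ⟨t, u⁻¹, c⁻¹, ht, hu.inv hc, inv_ne_zero hc, by rw [mul_inv, zpow_neg]⟩

lemma HasOrderAt.div (h2 : (2 : K) ≠ 0) (hf : HasOrderAt f P m) (hg : HasOrderAt g P n) :
    HasOrderAt (f / g) P (m - n) := by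
  simpa only [div_eq_mul_inv, sub_eq_add_neg] using hf.mul h2 hg.inv

lemma HasValueAt.hasOrderAt_zero (h2 : (2 : K) ≠ 0) (hf : HasValueAt f P c) (hc : c ≠ 0) :
    HasOrderAt f P 0 := by
  obtain ⟨t, ht, -⟩ := exists_isUniformizerAt h2 P
  exact ⟨t, f, c, ht, hf, hc, by simp⟩

lemma HasOrderAt.unique (h2 : (2 : K) ≠ 0) (hf : HasOrderAt f P m) (hf' : HasOrderAt f P n) :
    m = n := by
  suffices h : ∀ k : ℤ, HasOrderAt (1 : (curve A B).FunctionField) P k → k ≤ 0 by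
    have h1 := hf.div h2 hf'
    have h3 := hf'.div h2 hf
    rw [div_self (hf.ne_zero h2)] at h1 h3
    have := h _ h1
    have := h _ h3
    omega
  rintro k ⟨t, u, c, ht, hu, hc, h⟩
  by_contra hk
  -- A positive order would make the constant 1 vanish at `P`.
  obtain ⟨l, rfl⟩ := Int.eq_ofNat_of_zero_le (not_le.mp hk).le
  rw [zpow_natCast] at h
  have h1 := (ht.1.pow l).mul hu
  rw [← h, zero_pow (by omega), zero_mul] at h1
  exact one_ne_zero ((HasValueAt.one P).unique h1)

lemma HasOrderAt.exists_hasValueAt (hf : HasOrderAt f P 0) : ∃ c, HasValueAt f P c ∧ c ≠ 0 := by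
  obtain ⟨t, u, c, ht, hu, hc, rfl⟩ := hf
  exact ⟨c, by simpa using hu, hc⟩

/-- In characteristic `p`, the logarithmic derivative of a function whose order is divisible by `p`
is regular. -/
lemma HasOrderAt.exists_hasValueAt_invDer_div (h2 : (2 : K) ≠ 0) (p : ℕ) [CharP K p]
    (hf : HasOrderAt f P (p * n)) : ∃ c, HasValueAt (invDer A B h2 f / f) P c := by
  obtain ⟨t, u, c, ht, hu, hc, rfl⟩ := hf
  have : CharP (curve A B).FunctionField p :=
    charP_of_injective_algebraMap (algebraMap K (curve A B).FunctionField).injective p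
  obtain ⟨d, hd⟩ := hu.exists_invDer h2
  have h0 := zpow_ne_zero (p * n) (ht.ne_zero h2)
  -- The power is the p-th power of t^n. Only the logarithmic derivative of the unit `u` survives.
  have h1 : invDer A B h2 (t ^ (p * n)) = 0 := by
    rw [mul_comm, zpow_mul, zpow_natCast, Derivation.leibniz_pow]
    simp [CharP.cast_eq_zero]
  refine ⟨d / c, ?_⟩
  convert hd.div hu hc using 1
  rw [Derivation.leibniz, h1, smul_zero, add_zero, smul_eq_mul, mul_div_mul_left _ _ h0]

end Order

/-! ### Divisors of lines -/

section Divisors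

variable {K : Type*} [Field K] {A B : K}

/-- The function `L 0 * x + L 1 * y + L 2` on `E`. -/
noncomputable def formFun (A B : K) (L : Fin 3 → K) : (curve A B).FunctionField :=
  algebraMap K _ (L 0) * xF A B + algebraMap K _ (L 1) * yF A B + algebraMap K _ (L 2)

lemma formFun_hasValueAt (L : Fin 3 → K) {x y : K} (h : (curve A B).Nonsingular x y) :
    HasValueAt (formFun A B L) (.some x y h) (L 0 * x + L 1 * y + L 2) :=
  (((HasValueAt.const _ _).mul (.xF h)).add ((HasValueAt.const _ _).mul (.yF h))).add (.const _ _)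

lemma HasDivisor.mul (h2 : (2 : K) ≠ 0) {f g : (curve A B).FunctionField}
    {D D' : (curve A B).Point →₀ ℤ} (hf : HasDivisor f D) (hg : HasDivisor g D') :
    HasDivisor (f * g) (D + D') :=
  fun P => (hf P).mul h2 (hg P)

lemma HasDivisor.inv {f : (curve A B).FunctionField} {D : (curve A B).Point →₀ ℤ}
    (hf : HasDivisor f D) : HasDivisor f⁻¹ (-D) :=
  fun P => (hf P).inv

lemma HasDivisor.div (h2 : (2 : K) ≠ 0) {f g : (curve A B).FunctionField}
    {D D' : (curve A B).Point →₀ ℤ} (hf : HasDivisor f D) (hg : HasDivisor g D') :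
    HasDivisor (f / g) (D - D') :=
  fun P => (hf P).div h2 (hg P)

lemma HasDivisor.one (h2 : (2 : K) ≠ 0) : HasDivisor (1 : (curve A B).FunctionField) 0 :=
  fun P => (HasValueAt.one P).hasOrderAt_zero h2 one_ne_zero

lemma HasDivisor.pow (h2 : (2 : K) ≠ 0) {f : (curve A B).FunctionField}
    {D : (curve A B).Point →₀ ℤ} (hf : HasDivisor f D) (n : ℕ) : HasDivisor (f ^ n) (n • D) := by
  induction n with
  | zero => simpa using HasDivisor.one h2
  | succ n ih => simpa only [pow_succ, succ_nsmul] using ih.mul h2 hf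

lemma HasOrderAt.congr {f g : (curve A B).FunctionField} {P : (curve A B).Point} {m n : ℤ}
    (hf : HasOrderAt f P m) (h : f = g) (h' : m = n) : HasOrderAt g P n :=
  h ▸ h' ▸ hf

lemma hasOrderAt_inv_yF : HasOrderAt (1 / yF A B) .zero 3 := by
  obtain ⟨u, hu, h⟩ := exists_inv_yF_eq (A := A) (B := B)
  exact ⟨_, u, 1, isUniformizerAt_zero, hu, one_ne_zero, by rw [h]; norm_cast⟩

lemma hasOrderAt_xF_sub_zero (h2 : (2 : K) ≠ 0) (x : K) :
    HasOrderAt (xF A B - algebraMap K _ x) .zero (-2) := by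
  obtain ⟨u, hu, h⟩ := exists_inv_yF_eq (A := A) (B := B)
  -- With 1/y = (x/y)³ u one has x - c = (x/y)(1 - c (x/y)² u) / (1/y) for the constant c, of order
  -- 1 - 3 = -2.
  have hv := (HasValueAt.one (A := A) (B := B) .zero).sub ((HasValueAt.const .zero x).mul
    ((HasValueAt.xF_div_yF.pow 2).mul hu))
  have h1 : HasOrderAt (xF A B / yF A B * _) .zero 1 :=
    ⟨_, _, _, isUniformizerAt_zero, hv, by simp, by rw [zpow_one]⟩
  refine (h1.div h2 (hasOrderAt_inv_yF (A := A) (B := B))).congr ?_ (by norm_num)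
  have hy := yF_ne_zero (A := A) (B := B)
  have : algebraMap K (curve A B).FunctionField x * (1 / yF A B) = algebraMap K _ x *
    ((xF A B / yF A B) ^ 3 * u) := by rw [h]
  rw [div_eq_iff (one_div_ne_zero hy)]
  linear_combination this

lemma hasOrderAt_line_zero (h2 : (2 : K) ≠ 0) (m c : K) :
    HasOrderAt (formFun A B ![-m, 1, c]) .zero (-3) := by
  have hv := ((HasValueAt.one (A := A) (B := B) .zero).sub ((HasValueAt.const .zero m).mul
    HasValueAt.xF_div_yF)).add ((HasValueAt.const .zero c).mul HasValueAt.inv_yF)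
  have h1 := (hv.hasOrderAt_zero h2 (by simp)).div h2 (hasOrderAt_inv_yF (A := A) (B := B))
  refine h1.congr ?_ (by norm_num)
  have hy := yF_ne_zero (A := A) (B := B)
  simp [formFun]
  field_simp
  ring

lemma neg_some {x y : K} (h : (curve A B).Nonsingular x y) :
    ∃ h', -(WeierstrassCurve.Affine.Point.some x y h) = .some x (-y) h' := by
  have h1 := WeierstrassCurve.Affine.Point.neg_some h
  simp only [WeierstrassCurve.Affine.negY, zero_mul, sub_zero] at h1
  exact ⟨_, h1⟩

lemma formFun_vertical_some {x y : K} (h : (curve A B).Nonsingular x y) :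
    formFun A B (vertical (.some x y h)) = xF A B - algebraMap K _ x := by
  simp [formFun, vertical, sub_eq_add_neg]

lemma formFun_vertical_zero :
    formFun A B (vertical (0 : (curve A B).Point)) = 1 := by
  simp [formFun, vertical]

variable [DecidableEq K]

lemma single_neg_apply (P X : (curve A B).Point) (n : ℤ) :
    Finsupp.single (-P) n X = Finsupp.single P n (-X) := by
  by_cases h : X = -P
  · subst h
    simp
  · rw [Finsupp.single_eq_of_ne h, Finsupp.single_eq_of_ne]
    rintro rfl
    simp at h

/-- The zeros of the vertical line through `P` are `P` and `-P`. -/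
theorem hasDivisor_vertical (h2 : (2 : K) ≠ 0) (P : (curve A B).Point) :
    HasDivisor (formFun A B (vertical P))
      (Finsupp.single P 1 + Finsupp.single (-P) 1 - Finsupp.single 0 2) := by
  intro X
  match P with
  | .zero =>
    rw [← WeierstrassCurve.Affine.Point.zero_def, neg_zero, ← Finsupp.single_add,
      ← Finsupp.single_sub]
    rw [formFun_vertical_zero]
    simpa using (HasValueAt.one X).hasOrderAt_zero h2 one_ne_zero
  | .some x₀ y₀ h₀ =>
    obtain ⟨h₀', hneg⟩ := neg_some h₀
    rw [formFun_vertical_some, hneg]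
    simp only [Finsupp.coe_sub, Finsupp.coe_add, Pi.sub_apply, Pi.add_apply]
    match X with
    | .zero =>
      rw [Finsupp.single_eq_of_ne (by simp), Finsupp.single_eq_of_ne (by simp),
        ← WeierstrassCurve.Affine.Point.zero_def, Finsupp.single_eq_same]
      exact hasOrderAt_xF_sub_zero h2 x₀
    | .some x y h =>
      rw [Finsupp.single_eq_of_ne (a := 0) (WeierstrassCurve.Affine.Point.some_ne_zero h), sub_zero]
      by_cases hx : x = x₀
      · subst hx
        have h3 : (y - y₀) * (y + y₀) = 0 := by
          linear_combination equation_curve_iff.mp h.1 - equation_curve_iff.mp h₀.1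
        have hy : y = y₀ ∨ y = -y₀ := by
          simpa [sub_eq_zero, add_eq_zero_iff_eq_neg] using h3
        by_cases hy0 : y = 0
        -- At a point of order two the summands (P) and (-P) coincide, matching the double zero of x
        -- - x₀.
        · have : y₀ = 0 := by rcases hy with hy | hy <;> simpa [hy0] using hy.symm
          subst hy0 this
          simp only [neg_zero, Finsupp.single_eq_same]
          obtain ⟨u, c, hu, hc, he⟩ := exists_xF_sub_eq h
          exact ⟨_, u, c, isUniformizerAt_of_Y_eq_zero h, hu, hc, by rw [he]; norm_cast⟩
        · have h1 : HasOrderAt (xF A B - algebraMap K _ x) (.some x y h) 1 :=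
            ⟨_, 1, 1, isUniformizerAt_of_Y_ne_zero h2 h hy0, .one _, one_ne_zero, by simp⟩
          have hyy : y ≠ -y := fun hyy => mul_ne_zero h2 hy0 (by linear_combination hyy)
          rcases hy with hy | hy
          · subst hy
            rw [Finsupp.single_eq_same, Finsupp.single_eq_of_ne (by simp [hyy])]
            exact h1
          · obtain rfl : y₀ = -y := by rw [hy, neg_neg]
            rw [Finsupp.single_eq_of_ne (by simp [hyy])]
            simp only [neg_neg, Finsupp.single_eq_same]
            exact h1
      · rw [Finsupp.single_eq_of_ne (by simp [hx]), Finsupp.single_eq_of_ne (by simp [hx])]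
        exact ((HasValueAt.xF h).sub (.const _ x₀)).hasOrderAt_zero h2 (sub_ne_zero.mpr hx)

/-- The line function y - λ(x) times its conjugate y + λ(x) is x³ + Ax + B - λ(x)², whose roots are
the abscissas of the three intersection points. The divisor of a line is thereby reduced to those of
vertical lines. -/
lemma formFun_line_mul {x₁ x₂ y₁ y₂ : K} (h₁ : (curve A B).Equation x₁ y₁)
    (h₂ : (curve A B).Equation x₂ y₂) (hxy : ¬(x₁ = x₂ ∧ y₁ = -y₂)) :
    formFun A B ![-(curve A B).slope x₁ x₂ y₁ y₂, 1, (curve A B).slope x₁ x₂ y₁ y₂ * x₁ - y₁] *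
      formFun A B ![(curve A B).slope x₁ x₂ y₁ y₂, 1, -((curve A B).slope x₁ x₂ y₁ y₂ * x₁ - y₁)] =
    (xF A B - algebraMap K _ x₁) * (xF A B - algebraMap K _ x₂) * (xF A B - algebraMap K _
      ((curve A B).addX x₁ x₂ ((curve A B).slope x₁ x₂ y₁ y₂))) := by
  have h := WeierstrassCurve.Affine.addPolynomial_slope h₁ h₂ (by
    simpa [WeierstrassCurve.Affine.negY] using hxy)
  have h := congrArg (Polynomial.aeval (xF A B)) h
  simp [WeierstrassCurve.Affine.addPolynomial, WeierstrassCurve.Affine.polynomial,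
    WeierstrassCurve.Affine.linePolynomial] at h
  simp [formFun]
  linear_combination -h + yF_sq (A := A) (B := B)

/-- The line through two affine points that are not inverse to each other. -/
lemma hasDivisor_line_of_ne_neg (h2 : (2 : K) ≠ 0) {x₁ x₂ y₁ y₂ : K}
    (h₁ : (curve A B).Nonsingular x₁ y₁) (h₂ : (curve A B).Nonsingular x₂ y₂)
    (hxy : ¬(x₁ = x₂ ∧ y₁ = -y₂)) :
    HasDivisor (formFun A B ![-(curve A B).slope x₁ x₂ y₁ y₂, 1,
      (curve A B).slope x₁ x₂ y₁ y₂ * x₁ - y₁])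
      (Finsupp.single (.some x₁ y₁ h₁) 1 + Finsupp.single (.some x₂ y₂ h₂) 1 +
        Finsupp.single (-(.some x₁ y₁ h₁ + .some x₂ y₂ h₂)) 1 - Finsupp.single 0 3) := by
  have hmul := formFun_line_mul h₁.1 h₂.1 hxy
  have hxy' : ¬(x₁ = x₂ ∧ y₁ = (curve A B).negY x₂ y₂) := by
    simpa [WeierstrassCurve.Affine.negY] using hxy
  have hline : y₂ = (curve A B).slope x₁ x₂ y₁ y₂ * (x₂ - x₁) + y₁ := by
    by_cases hx : x₁ = x₂
    · have := WeierstrassCurve.Affine.Y_eq_of_Y_ne h₁.1 h₂.1 hx (fun h => hxy' ⟨hx, h⟩)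
      rw [hx, this]
      ring
    · rw [WeierstrassCurve.Affine.slope_of_X_ne hx]
      field_simp [sub_ne_zero.mpr hx]
      ring
  have hadd := WeierstrassCurve.Affine.Point.add_some hxy' (h₁ := h₁) (h₂ := h₂)
  set m := (curve A B).slope x₁ x₂ y₁ y₂ with hm
  set x₃ := (curve A B).addX x₁ x₂ m with hx₃
  obtain ⟨y₃, h₃, hS, hy₃⟩ : ∃ y₃ h₃, -(WeierstrassCurve.Affine.Point.some x₁ y₁ h₁ +
      .some x₂ y₂ h₂) = .some x₃ y₃ h₃ ∧ y₃ = m * (x₃ - x₁) + y₁ := by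
    obtain ⟨h', hn⟩ := neg_some (WeierstrassCurve.Affine.nonsingular_add h₁ h₂ hxy')
    refine ⟨_, h', by rw [hadd, hn], ?_⟩
    simp [WeierstrassCurve.Affine.addY, WeierstrassCurve.Affine.negAddY,
      WeierstrassCurve.Affine.negY, hx₃, hm]
  rw [hS]
  have hprod := ((hasDivisor_vertical h2 (.some x₁ y₁ h₁)).mul h2
    (hasDivisor_vertical h2 (.some x₂ y₂ h₂))).mul h2 (hasDivisor_vertical h2 (.some x₃ y₃ h₃))
  simp only [formFun_vertical_some] at hprod
  rw [← hmul] at hprod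
  intro X
  match X with
  | .zero =>
    refine (hasOrderAt_line_zero h2 m (m * x₁ - y₁)).congr rfl ?_
    simp [← WeierstrassCurve.Affine.Point.zero_def]
  | .some x y h =>
    have hX := hprod (.some x y h)
    have h0 (n : ℤ) : Finsupp.single (0 : (curve A B).Point) n (.some x y h) = 0 :=
      Finsupp.single_eq_of_ne (WeierstrassCurve.Affine.Point.some_ne_zero h)
    -- A point off the line is none of the three intersection points.
    have key (x' y' : K) (h' : (curve A B).Nonsingular x' y') (hl : y' ≠ m * (x' - x₁) + y₁) :
        Finsupp.single (WeierstrassCurve.Affine.Point.some x₁ y₁ h₁)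
          (1 : ℤ) (.some x' y' h') +
        Finsupp.single (WeierstrassCurve.Affine.Point.some x₂ y₂ h₂)
          (1 : ℤ) (.some x' y' h') +
        Finsupp.single (WeierstrassCurve.Affine.Point.some x₃ y₃ h₃)
          (1 : ℤ) (.some x' y' h') = 0 := by
      rw [Finsupp.single_eq_of_ne, Finsupp.single_eq_of_ne, Finsupp.single_eq_of_ne]
      · rfl
      all_goals
        intro he
        simp only [WeierstrassCurve.Affine.Point.some.injEq] at he
        obtain ⟨rfl, rfl⟩ := he
        refine hl ?_
        first | assumption | ring
    simp only [Finsupp.coe_sub, Finsupp.coe_add, Pi.sub_apply, Pi.add_apply, h0, sub_zero,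
      single_neg_apply] at hX ⊢
    have hv := formFun_hasValueAt ![-m, 1, m * x₁ - y₁] h
    have hv' := formFun_hasValueAt ![m, 1, -(m * x₁ - y₁)] h
    simp only [Matrix.cons_val] at hv hv'
    obtain ⟨hn, hneg⟩ := neg_some h
    rw [hneg] at hX
    -- The order of line times conjugate at X is the multiplicity of X plus that of -X. It is
    -- attributed to the line according to which of the two factors vanishes at X; both vanish only
    -- if y = 0.
    by_cases hl : y = m * (x - x₁) + y₁
    · by_cases hl' : -y = m * (x - x₁) + y₁
      · obtain rfl : y = 0 := by
          have : 2 * y = 0 := by linear_combination hl - hl'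
          exact (mul_eq_zero.mp this).resolve_left h2
        obtain ⟨u, c, hu, hc, he⟩ := exists_xF_sub_eq h
        -- Since x - x₀ = y² u, the function y + m'(x - x₀) is y(1 + m' y u), with a simple zero.
        -- The line and its conjugate are the cases m' = -m and m' = m, so each takes half of the
        -- order of the product.
        have hord (m' : K) : HasOrderAt (yF A B + algebraMap K _ m' * (xF A B - algebraMap K _ x))
            (.some x 0 h) 1 := by
          refine ⟨_, _, _, isUniformizerAt_of_Y_eq_zero h, (HasValueAt.one _).add
            ((((HasValueAt.const _ m').mul (.yF h)).mul hu)), by simp, ?_⟩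
          rw [he, zpow_one]
          ring
        have hc := congrArg (algebraMap K (curve A B).FunctionField) hl
        simp only [map_zero, map_add, map_mul, map_sub] at hc
        have ho1 : HasOrderAt (formFun A B ![-m, 1, m * x₁ - y₁]) (.some x 0 h) 1 := by
          refine (hord (-m)).congr ?_ rfl
          simp [formFun]
          linear_combination -hc
        have ho2 : HasOrderAt (formFun A B ![m, 1, -(m * x₁ - y₁)]) (.some x 0 h) 1 := by
          refine (hord m).congr ?_ rfl
          simp [formFun]
          linear_combination hc
        have := hX.unique h2 (ho1.mul h2 ho2)
        simp only [neg_zero] at this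
        exact ho1.congr rfl (by omega)
      · have ho2 := hv'.hasOrderAt_zero h2 (fun h0 => hl' (by linear_combination -h0))
        have h3 := hX.div h2 ho2
        -- The conjugate is a unit at X, so the line carries the whole order; -X is off the line and
        -- contributes nothing.
        rw [mul_div_cancel_right₀ _ (ho2.ne_zero h2)] at h3
        refine h3.congr rfl ?_
        have := key x (-y) hn hl'
        omega
    · exact (hv.hasOrderAt_zero h2 (fun h0 => hl (by linear_combination h0))).congr rfl
        (key x y h hl).symm

/-- The divisor of the line through `P` and `Q`, in all cases. -/
theorem hasDivisor_line (h2 : (2 : K) ≠ 0) (P Q : (curve A B).Point) :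
    HasDivisor (formFun A B (line P Q))
      (Finsupp.single P 1 + Finsupp.single Q 1 + Finsupp.single (-(P + Q)) 1 -
        Finsupp.single 0 3) := by
  have h3 : Finsupp.single (0 : (curve A B).Point) (3 : ℤ) =
    Finsupp.single 0 1 + Finsupp.single 0 2 := by rw [← Finsupp.single_add]; norm_num
  match P, Q with
  | .zero, Q =>
    have h := hasDivisor_vertical h2 Q
    have he : Finsupp.single Q (1 : ℤ) + Finsupp.single (-Q) 1 - Finsupp.single 0 2 =
        Finsupp.single 0 1 + Finsupp.single Q 1 + Finsupp.single (-(0 + Q)) 1 -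
          Finsupp.single 0 3 := by
      rw [zero_add, h3]
      abel
    rw [he] at h
    exact h
  | .some x₁ y₁ h₁, .zero =>
    have h := hasDivisor_vertical h2 (.some x₁ y₁ h₁)
    have he (P : (curve A B).Point) : Finsupp.single P (1 : ℤ) + Finsupp.single (-P) 1 - Finsupp.single 0 2 =
        Finsupp.single P 1 + Finsupp.single 0 1 + Finsupp.single (-(P + 0)) 1 -
          Finsupp.single 0 3 := by
      rw [add_zero, h3]
      abel
    rw [he] at h
    exact h
  | .some x₁ y₁ h₁, .some x₂ y₂ h₂ =>
    by_cases hxy : x₁ = x₂ ∧ y₁ = -y₂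
    · obtain ⟨hn, hneg⟩ := neg_some h₁
      have hQ : WeierstrassCurve.Affine.Point.some x₂ y₂ h₂ = -.some x₁ y₁ h₁ := by
        rw [hneg]
        simp [hxy]
      have hL : line (.some x₁ y₁ h₁) (.some x₂ y₂ h₂) = vertical (.some x₁ y₁ h₁) := by
        simp only [line, if_pos hxy, vertical]
      rw [hL, hQ, add_neg_cancel, neg_zero, h3]
      convert hasDivisor_vertical h2 (.some x₁ y₁ h₁) using 1
      abel
    · simp only [line, if_neg hxy]
      exact hasDivisor_line_of_ne_neg h2 h₁ h₂ hxy

/-- The function `ℓ / v` with the divisor `(P) + (Q) - (P + Q) - (O)`. -/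
lemma hasDivisor_line_div_vertical (h2 : (2 : K) ≠ 0) (P Q : (curve A B).Point) :
    HasDivisor (formFun A B (line P Q) / formFun A B (vertical (P + Q)))
      (Finsupp.single P 1 + Finsupp.single Q 1 - Finsupp.single (P + Q) 1 - Finsupp.single 0 1) := by
  convert (hasDivisor_line h2 P Q).div h2 (hasDivisor_vertical h2 (P + Q)) using 1
  have h3 : Finsupp.single (0 : (curve A B).Point) (3 : ℤ) =
    Finsupp.single 0 1 + Finsupp.single 0 2 := by rw [← Finsupp.single_add]; norm_num
  rw [h3]
  abel

/-- A divisor of degree zero with sum `P` is linearly equivalent to `(P) - (O)`. -/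
theorem exists_hasDivisor (h2 : (2 : K) ≠ 0) (D : (curve A B).Point →₀ ℤ) :
    ∃ g, HasDivisor g (D - Finsupp.single (D.sum fun X n => n • X) 1 -
      Finsupp.single 0 ((D.sum fun _ n => n) - 1)) := by
  let s : ((curve A B).Point →₀ ℤ) →+ (curve A B).Point :=
    Finsupp.liftAddHom fun X => (zmultiplesHom _ X)
  let d : ((curve A B).Point →₀ ℤ) →+ ℤ := Finsupp.liftAddHom fun _ => AddMonoidHom.id ℤ
  -- Stated for every degree, D ~ (s D) + (d D - 1)(O) can be proved by induction on D.
  change ∃ g, HasDivisor g (D - Finsupp.single (s D) 1 - Finsupp.single 0 (d D - 1))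
  have hs1 (X) : s (Finsupp.single X 1) = X := by simp [s]
  have hd1 (X) : d (Finsupp.single X 1) = 1 := by simp [d]
  clear_value s d
  have hadd {D D'} (h : ∃ g, HasDivisor g (D - Finsupp.single (s D) 1 - Finsupp.single 0 (d D - 1)))
      (h' : ∃ g, HasDivisor g (D' - Finsupp.single (s D') 1 - Finsupp.single 0 (d D' - 1))) :
      ∃ g, HasDivisor g (D + D' - Finsupp.single (s (D + D')) 1 -
        Finsupp.single 0 (d (D + D') - 1)) := by
    obtain ⟨g, hg⟩ := h
    obtain ⟨g', hg'⟩ := h'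
    -- The quotient ℓ / v trades (s D) + (s D') for (s D + s D') + (O), which is the only correction
    -- needed for sums.
    refine ⟨g * g' * (formFun A B (line (s D) (s D')) / formFun A B (vertical (s D + s D'))), ?_⟩
    convert (hg.mul h2 hg').mul h2 (hasDivisor_line_div_vertical h2 (s D) (s D')) using 1
    simp only [map_add, Finsupp.single_sub, Finsupp.single_add]
    abel
  have hneg {D} (h : ∃ g, HasDivisor g (D - Finsupp.single (s D) 1 -
      Finsupp.single 0 (d D - 1))) : ∃ g, HasDivisor g (-D - Finsupp.single (s (-D)) 1 -
        Finsupp.single 0 (d (-D) - 1)) := by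
    obtain ⟨g, hg⟩ := h
    -- The vertical line trades -(s D) for (-s D) - 2(O).
    refine ⟨g⁻¹ / formFun A B (vertical (s D)), ?_⟩
    convert hg.inv.div h2 (hasDivisor_vertical h2 (s D)) using 1
    have h3 : Finsupp.single (0 : (curve A B).Point) (2 : ℤ) =
      Finsupp.single 0 1 + Finsupp.single 0 1 := by rw [← Finsupp.single_add]; norm_num
    simp only [map_neg, Finsupp.single_sub, Finsupp.single_neg, h3]
    abel
  have hone (X) : ∃ g, HasDivisor g (Finsupp.single X 1 - Finsupp.single (s (Finsupp.single X 1)) 1 -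
      Finsupp.single 0 (d (Finsupp.single X 1) - 1)) := by
    refine ⟨1, ?_⟩
    rw [hs1, hd1, sub_self, sub_self, Finsupp.single_zero, sub_zero]
    exact HasDivisor.one h2
  have hzero : ∃ g, HasDivisor g (0 - Finsupp.single (s 0) 1 - Finsupp.single 0 (d 0 - 1)) := by
    refine ⟨1, ?_⟩
    rw [map_zero, map_zero]
    simp only [zero_sub, Finsupp.single_neg, sub_neg_eq_add, neg_add_cancel]
    exact HasDivisor.one h2
  induction D using Finsupp.induction_linear with
  | zero => exact hzero
  | add D D' h h' => exact hadd h h'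
  | single X n =>
    induction n with
    | zero =>
      rw [Finsupp.single_zero]
      exact hzero
    | succ n ih =>
      rw [Finsupp.single_add]
      exact hadd ih (hone X)
    | pred n ih =>
      have hn : Finsupp.single X (-(n : ℤ) - 1) = Finsupp.single X (-(n : ℤ)) +
          -Finsupp.single X 1 := by rw [Finsupp.single_sub, sub_eq_add_neg]
      rw [hn]
      have h := hneg (hone X)
      exact hadd ih h

end Divisors

/-! ### Logarithmic derivatives -/

section LogDer

variable {K : Type*} [Field K] {A B : K}

/-- The logarithmic derivative with respect to the invariant derivation `2 y d/dx`. -/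
noncomputable def logDer (h2 : (2 : K) ≠ 0) (f : (curve A B).FunctionField) :
    (curve A B).FunctionField :=
  invDer A B h2 f / f

lemma logDer_mul (h2 : (2 : K) ≠ 0) {f g : (curve A B).FunctionField} (hf : f ≠ 0) (hg : g ≠ 0) :
    logDer h2 (f * g) = logDer h2 f + logDer h2 g := by
  simp only [logDer, Derivation.leibniz, smul_eq_mul]
  field_simp
  ring

lemma logDer_inv (h2 : (2 : K) ≠ 0) {f : (curve A B).FunctionField} (hf : f ≠ 0) :
    logDer h2 f⁻¹ = -logDer h2 f := by
  simp only [logDer, Derivation.leibniz_inv, smul_eq_mul]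
  field_simp

lemma logDer_div (h2 : (2 : K) ≠ 0) {f g : (curve A B).FunctionField} (hf : f ≠ 0) (hg : g ≠ 0) :
    logDer h2 (f / g) = logDer h2 f - logDer h2 g := by
  rw [div_eq_mul_inv, logDer_mul h2 hf (inv_ne_zero hg), logDer_inv h2 hg, sub_eq_add_neg]

lemma logDer_algebraMap (h2 : (2 : K) ≠ 0) (c : K) :
    logDer h2 (algebraMap K (curve A B).FunctionField c) = 0 := by
  simp [logDer]

lemma logDer_one (h2 : (2 : K) ≠ 0) : logDer h2 (1 : (curve A B).FunctionField) = 0 := by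
  simp [logDer]

lemma logDer_pow_char (h2 : (2 : K) ≠ 0) (p : ℕ) [CharP K p] (f : (curve A B).FunctionField) :
    logDer h2 (f ^ p) = 0 := by
  have : CharP (curve A B).FunctionField p :=
    charP_of_injective_algebraMap (algebraMap K (curve A B).FunctionField).injective p
  simp [logDer, Derivation.leibniz_pow]

lemma HasDivisor.ne_zero (h2 : (2 : K) ≠ 0) {f : (curve A B).FunctionField}
    {D : (curve A B).Point →₀ ℤ} (hf : HasDivisor f D) : f ≠ 0 :=
  (hf .zero).ne_zero h2

lemma HasDivisor.value_ne_zero {f : (curve A B).FunctionField}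
    {D : (curve A B).Point →₀ ℤ} (hf : HasDivisor f D) {P : (curve A B).Point} {c : K}
    (hP : D P = 0) (hc : HasValueAt f P c) : c ≠ 0 := by
  obtain ⟨d, hd, hd0⟩ := ((hf P).congr rfl hP).exists_hasValueAt
  rwa [hc.unique hd]

variable [IsAlgClosed K] (p : ℕ) [CharP K p]

/-- The logarithmic derivative of a function whose divisor is divisible by the characteristic is
constant. -/
theorem exists_logDer_eq (h2 : (2 : K) ≠ 0) (hE : 4 * A ^ 3 + 27 * B ^ 2 ≠ 0)
    {f : (curve A B).FunctionField} {D : (curve A B).Point →₀ ℤ} (hf : HasDivisor f (p • D)) :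
    ∃ c, logDer h2 f = algebraMap K _ c :=
  exists_eq_algebraMap_of_regular h2 hE fun P =>
    ((hf P).congr (n := p * D P) rfl (by simp)).exists_hasValueAt_invDer_div h2 p

/-- This constant depends only on the sum of the divisor. -/
theorem logDer_eq_of_sum_eq [DecidableEq K] (h2 : (2 : K) ≠ 0) (hE : 4 * A ^ 3 + 27 * B ^ 2 ≠ 0)
    {f f' : (curve A B).FunctionField} {D D' : (curve A B).Point →₀ ℤ}
    (hf : HasDivisor f (p • D)) (hf' : HasDivisor f' (p • D'))
    (hdeg : (D.sum fun _ n => n) = D'.sum fun _ n => n)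
    (hsum : (D.sum fun X n => n • X) = D'.sum fun X n => n • X) : logDer h2 f = logDer h2 f' := by
  -- The difference has degree 0 and sum O, so the correction terms at O cancel and `D - D'` itself
  -- is principal.
  obtain ⟨g, hg⟩ := exists_hasDivisor h2 (D - D')
  rw [Finsupp.sum_sub_index (fun _ _ _ => sub_smul _ _ _), hsum, sub_self,
    Finsupp.sum_sub_index (fun _ _ _ => rfl), hdeg, sub_self, zero_sub, Finsupp.single_neg,
    sub_neg_eq_add, sub_add_cancel] at hg
  have h := (hf.div h2 hf').div h2 (hg.pow h2 p)
  -- The function f / f' / g^p has neither zeros nor poles, and g^p has logarithmic derivative zero.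
  obtain ⟨c, hc⟩ := exists_eq_algebraMap_of_regular h2 hE fun P => by
    obtain ⟨c, hc, -⟩ := ((h P).congr rfl (by rw [smul_sub, sub_self]; rfl)).exists_hasValueAt
    exact ⟨c, hc⟩
  have h0 := hf.ne_zero h2
  have h0' := hf'.ne_zero h2
  have hg0 := hg.ne_zero h2
  have := congrArg (logDer h2) hc
  rw [logDer_div h2 (div_ne_zero h0 h0') (pow_ne_zero _ hg0), logDer_div h2 h0 h0',
    logDer_pow_char, logDer_algebraMap, sub_zero, sub_eq_zero] at this
  exact this

end LogDer

/-! ### Addition chains and divisors -/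

section Chains

variable {K : Type*} [Field K] {A B : K}

lemma formFun_Z : formFun A B ![0, 0, 1] = 1 := by
  simp [formFun]

variable [DecidableEq K] {p : ℕ} {P : (curve A B).Point}

/-- The function `h_{i,j}` before the translation, as an element of the function field. -/
noncomputable def hFun (p : ℕ) (P : (curve A B).Point) (i j : ℕ) : (curve A B).FunctionField :=
  formFun A B (hNum p P i j) / formFun A B (hDen p P i j)

/-- One formula covers both kinds of step: if i + j = p then jP = -iP and (i + j)P = O, and it
becomes the divisor of the vertical line v_i. -/
lemma hasDivisor_hFun (h2 : (2 : K) ≠ 0) (hP : p • P = 0) (i j : ℕ) :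
    HasDivisor (hFun p P i j) (Finsupp.single (i • P) 1 + Finsupp.single (j • P) 1 -
      Finsupp.single ((i + j) • P) 1 - Finsupp.single 0 1) := by
  by_cases hij : i + j = p
  · rw [hFun, hNum, hDen, if_pos hij, if_pos hij, formFun_Z, div_one]
    have hj : j • P = -(i • P) := by
      rw [eq_neg_iff_add_eq_zero, ← add_nsmul, add_comm, hij, hP]
    rw [hj, hij, hP, sub_sub, ← Finsupp.single_add]
    exact hasDivisor_vertical h2 (i • P)
  · rw [hFun, hNum, hDen, if_neg hij, if_neg hij, add_nsmul]
    exact hasDivisor_line_div_vertical h2 (i • P) (j • P)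

/-- Telescoping: a step replaces (i+j)P by iP and jP in the sum of the (mP) - (O) and preserves the
sum of the multiset, and the difference is the divisor of h_{i,j}. A multiset of ones gives 0; the
start {p} gives p(P) - p(O), because pP = O. -/
lemma Decomposes.hasDivisor (h2 : (2 : K) ≠ 0) (hP : p • P = 0) {S : Finset ℕ} {M : Multiset ℕ}
    {C : List (ℕ × ℕ)} (h : Decomposes S M C) :
    HasDivisor ((C.map fun s => hFun p P s.1 s.2).prod)
      (M.sum • (Finsupp.single P 1 - Finsupp.single 0 1) -
        (M.map fun m => Finsupp.single (m • P) (1 : ℤ) - Finsupp.single 0 1).sum) := by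
  induction h with
  | ones m =>
    rw [Multiset.map_replicate, Multiset.sum_replicate, Multiset.sum_replicate, one_nsmul,
      smul_eq_mul, mul_one, sub_self]
    exact HasDivisor.one h2
  | @step i j M C hi hj hij h ih =>
    rw [List.map_cons, List.prod_cons]
    convert (hasDivisor_hFun h2 hP i j).mul h2 ih using 1
    simp only [Multiset.sum_cons, Multiset.map_cons, add_assoc]
    abel

/-- The product of the functions `h_{i,j}` over an addition chain decomposition of `p` has the
divisor `p (P) - p (O)`. -/
theorem IsChainDecomposition.hasDivisor (h2 : (2 : K) ≠ 0) (hP : p • P = 0) {C : List (ℕ × ℕ)}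
    (h : IsChainDecomposition p C) : HasDivisor ((C.map fun s => hFun p P s.1 s.2).prod)
      (p • (Finsupp.single P 1 - Finsupp.single 0 1)) := by
  obtain ⟨S, -, h⟩ := h
  simpa [hP] using h.hasDivisor h2 hP

end Chains

/-! ### Points over the dual numbers -/

section Dual

variable {K : Type*} [Field K] {A B : K}

/-- The point `O_k + (x, y)`. -/
noncomputable def shift (A k x y : K) : Fin 3 → K[ε] :=
  ![algebraMap K K[ε] x - (2 * k * y) • DualNumber.eps,
    algebraMap K K[ε] y - (k * (3 * x ^ 2 + A)) • DualNumber.eps, 1]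

lemma fst_algebraMap (c : K) : (algebraMap K K[ε] c).fst = c := rfl

lemma snd_algebraMap (c : K) : (algebraMap K K[ε] c).snd = 0 := rfl

lemma fst_three : (3 : K[ε]).fst = 3 := by
  rw [← map_ofNat (algebraMap K K[ε]) 3, fst_algebraMap]

lemma snd_three : (3 : K[ε]).snd = 0 := by
  rw [← map_ofNat (algebraMap K K[ε]) 3, snd_algebraMap]

lemma isUnit_of_fst_ne_zero {z : K[ε]} (hz : z.fst ≠ 0) : IsUnit z :=
  TrivSqZeroExt.isUnit_iff_isUnit_fst.mpr (isUnit_iff_ne_zero.mpr hz)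

lemma addClass_eq_of_addLaw₁ {S : Type*} [CommRing S] (a b : S) {X Y Z : Fin 3 → S} {u : S}
    (hu : IsUnit u) (hZ : Z 2 = 1) (h : addLaw₁ a b X Y = u • Z) :
    addClass a b ⟦X⟧ ⟦Y⟧ = ⟦Z⟧ := by
  have hp : IsPrimitive (addLaw₁ a b X Y) := ⟨2, by simpa [h, hZ] using hu⟩
  change (⟦addRep a b X Y⟧ : PointClass S) = _
  rw [addRep, if_pos hp, h]
  exact WeierstrassCurve.Projective.smul_eq Z hu

lemma liftPt_some {x y : K} (h : (curve A B).Nonsingular x y) :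
    liftPt (.some x y h) = ⟦shift A 0 x y⟧ := by
  rw [liftPt]
  congr 1
  ext i <;> fin_cases i <;> simp [coords, shift]

/-- The ε-parts -2ky and -k(3x² + A) are -k times the derivatives of x and y under 2y d/dx. The
first law returns these coordinates up to the factor -1. -/
lemma dualAdd_infPt_liftPt (k : K) {x y : K} (h : (curve A B).Nonsingular x y) :
    dualAdd A B (infPt k) (liftPt (.some x y h)) = ⟦shift A k x y⟧ := by
  rw [liftPt_some]
  refine addClass_eq_of_addLaw₁ (u := -1) _ _ isUnit_one.neg (by simp [shift]) ?_
  ext i <;> fin_cases i <;> simp [addLaw₁, shift, fst_algebraMap, snd_algebraMap, fst_three] <;> ring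

/-- Both points reduce to O, where the first law takes only non-invertible values, so the second law
decides. -/
lemma dualAdd_infPt_infPt (k k' : K) :
    dualAdd A B (infPt k) (infPt k') = infPt (k + k') := by
  have h : ¬ IsPrimitive (addLaw₁ (algebraMap K K[ε] A) (algebraMap K K[ε] B)
      ![k • DualNumber.eps, 1, 0] ![k' • DualNumber.eps, 1, 0]) := by
    rintro ⟨i, hi⟩
    rw [TrivSqZeroExt.isUnit_iff_isUnit_fst] at hi
    fin_cases i <;> simp [addLaw₁] at hi
  change (⟦addRep _ _ _ _⟧ : PointClass K[ε]) = _
  rw [addRep, if_neg h, infPt]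
  congr 1
  ext i <;> fin_cases i <;> simp [addLaw₂]

/-- This is the translation invariance of 2y d/dx: the chord construction carries the tangent vector
at the first point to the one at the sum. The common factor `u` is minus the cube of the difference
of the abscissas, a unit because they differ. -/
lemma addLaw₁_shift {k x₁ y₁ x₂ y₂ m : K} (h₁ : (curve A B).Equation x₁ y₁)
    (h₂ : (curve A B).Equation x₂ y₂) (hm : m * (x₁ - x₂) = y₁ - y₂) {x₃ y₃ : K}
    (hx₃ : x₃ = m ^ 2 - x₁ - x₂) (hy₃ : y₃ = -(m * (x₃ - x₁) + y₁)) (hx : x₁ ≠ x₂) :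
    ∃ u : K[ε], IsUnit u ∧ addLaw₁ (algebraMap K K[ε] A) (algebraMap K K[ε] B) (shift A k x₁ y₁)
      (shift A 0 x₂ y₂) = u • shift A k x₃ y₃ := by
  have hd := sub_ne_zero.mpr hx
  rw [equation_curve_iff] at h₁ h₂
  refine ⟨-(shift A k x₁ y₁ 0 - shift A 0 x₂ y₂ 0) ^ 3, ?_, ?_⟩
  · apply isUnit_of_fst_ne_zero
    simpa [shift, fst_algebraMap] using hd
  obtain rfl : y₁ = y₂ + m * (x₁ - x₂) := by linear_combination -hm
  -- Two points and the chord determine the curve: with A and B eliminated, the claim is a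
  -- polynomial identity in free variables.
  have hA : A = 2 * m * y₂ + m ^ 2 * (x₁ - x₂) - (x₁ ^ 2 + x₁ * x₂ + x₂ ^ 2) := by
    refine mul_left_cancel₀ hd ?_
    linear_combination h₂ - h₁
  have hB : B = y₂ ^ 2 - x₂ ^ 3 - A * x₂ := by linear_combination -h₂
  clear hm h₁ h₂
  subst hB hA hx₃ hy₃
  ext i <;> fin_cases i <;> simp [addLaw₁, shift, fst_algebraMap, snd_algebraMap, fst_three,
    snd_three, pow_succ] <;> ring

lemma equation_shift {k x y : K} (h : (curve A B).Equation x y) :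
    WeierstrassCurve.Projective.Equation (curve (algebraMap K K[ε] A) (algebraMap K K[ε] B))
      (shift A k x y) := by
  rw [equation_curve_iff] at h
  rw [shift, WeierstrassCurve.Projective.equation_some]
  refine equation_curve_iff.mpr ?_
  ext <;> simp [fst_algebraMap, snd_algebraMap, pow_succ]
  · linear_combination h
  · ring

lemma shift_mem_dualPoints {k x y : K} (h : (curve A B).Equation x y) :
    (⟦shift A k x y⟧ : PointClass K[ε]) ∈ dualPoints A B :=
  ⟨_, rfl, ⟨2, by simp [shift]⟩, equation_shift h⟩

/-- First-order expansion of a linear form; the ε-coefficient is -k times its derivative under 2y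
d/dx. -/
lemma evalForm_shift (L : Fin 3 → K) (k x y : K) : evalForm L (shift A k x y) =
    algebraMap K K[ε] (L 0 * x + L 1 * y + L 2) -
      (k * (L 0 * (2 * y) + L 1 * (3 * x ^ 2 + A))) • DualNumber.eps := by
  simp only [evalForm, Fin.sum_univ_three]
  ext <;> simp [shift, fst_algebraMap, snd_algebraMap]
  ring

lemma infPt_injective {k : K} (h : infPt k = infPt 0) : k = 0 := by
  obtain ⟨u, hu⟩ := Quotient.exact h
  have h0 := congrFun hu 0
  have h1 := congrFun hu 1
  simp [Units.smul_def] at h0 h1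
  have := congrArg TrivSqZeroExt.snd h0
  simpa using this.symm

/-- The values of `N / D` at `O_k + W` and at `W` have the ratio given by the logarithmic
derivative of `N / D`. -/
lemma ratio_mul_inverse_ratio {N D : Fin 3 → K} {k x y : K} (hN : N 0 * x + N 1 * y + N 2 ≠ 0)
    (hD : D 0 * x + D 1 * y + D 2 ≠ 0) :
    ratio N D ⟦shift A k x y⟧ * Ring.inverse (ratio N D ⟦shift A 0 x y⟧) =
      1 - (k * ((N 0 * (2 * y) + N 1 * (3 * x ^ 2 + A)) / (N 0 * x + N 1 * y + N 2) -
        (D 0 * (2 * y) + D 1 * (3 * x ^ 2 + A)) / (D 0 * x + D 1 * y + D 2))) • DualNumber.eps := by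
  change evalForm N (shift A k x y) * Ring.inverse (evalForm D (shift A k x y)) *
    Ring.inverse (evalForm N (shift A 0 x y) * Ring.inverse (evalForm D (shift A 0 x y))) = _
  simp only [evalForm_shift, zero_mul, zero_smul, sub_zero]
  generalize N 0 * x + N 1 * y + N 2 = n at *
  generalize D 0 * x + D 1 * y + D 2 = d at *
  generalize N 0 * (2 * y) + N 1 * (3 * x ^ 2 + A) = n'
  generalize D 0 * (2 * y) + D 1 * (3 * x ^ 2 + A) = d'
  have hd : IsUnit (algebraMap K K[ε] d - (k * d') • DualNumber.eps) :=
    isUnit_of_fst_ne_zero (by simpa [fst_algebraMap] using hD)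
  have hd0 : IsUnit (algebraMap K K[ε] d) := isUnit_of_fst_ne_zero hD
  have hn0 : IsUnit (algebraMap K K[ε] n) := isUnit_of_fst_ne_zero hN
  rw [Ring.mul_inverse_rev, Ring.inverse_inverse hd0]
  refine (hd.mul hn0).mul_right_cancel ?_
  have e1 := Ring.inverse_mul_cancel _ hd
  have e2 := Ring.inverse_mul_cancel _ hn0
  have e3 : (algebraMap K K[ε] n - (k * n') • DualNumber.eps) * algebraMap K K[ε] d =
      (1 - (k * (n' / n - d' / d)) • DualNumber.eps) *
        ((algebraMap K K[ε] d - (k * d') • DualNumber.eps) * algebraMap K K[ε] n) := by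
    ext <;> simp [fst_algebraMap, snd_algebraMap]
    · ring
    · field_simp
      ring
  rw [← e3]
  linear_combination (algebraMap K K[ε] n - (k * n') • DualNumber.eps) * algebraMap K K[ε] d *
    Ring.inverse (algebraMap K K[ε] n) * algebraMap K K[ε] n * e1 +
    (algebraMap K K[ε] n - (k * n') • DualNumber.eps) * algebraMap K K[ε] d * e2

variable [DecidableEq K]

/-- Translations commute with the addition of a point at infinity. -/
lemma dualAdd_shift_liftPt {x₁ y₁ x₂ y₂ : K} (h₁ : (curve A B).Nonsingular x₁ y₁)
    (h₂ : (curve A B).Nonsingular x₂ y₂) (hx : x₁ ≠ x₂) :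
    ∃ x₃ y₃ h₃, WeierstrassCurve.Affine.Point.some x₁ y₁ h₁ + .some x₂ y₂ h₂ = .some x₃ y₃ h₃ ∧
      ∀ k, dualAdd A B ⟦shift A k x₁ y₁⟧ (liftPt (.some x₂ y₂ h₂)) = ⟦shift A k x₃ y₃⟧ := by
  refine ⟨_, _, _, WeierstrassCurve.Affine.Point.add_some (fun h => hx h.1), fun k => ?_⟩
  rw [liftPt_some]
  obtain ⟨u, hu, h⟩ := addLaw₁_shift (k := k) h₁.1 h₂.1 (m := (curve A B).slope x₁ x₂ y₁ y₂)
    (x₃ := (curve A B).addX x₁ x₂ ((curve A B).slope x₁ x₂ y₁ y₂))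
    (y₃ := (curve A B).addY x₁ x₂ y₁ ((curve A B).slope x₁ x₂ y₁ y₂)) (by
      rw [WeierstrassCurve.Affine.slope_of_X_ne hx, div_mul_cancel₀ _ (sub_ne_zero.mpr hx)])
    (by simp [WeierstrassCurve.Affine.addX])
    (by simp [WeierstrassCurve.Affine.addY, WeierstrassCurve.Affine.negAddY,
      WeierstrassCurve.Affine.negY]) hx
  exact addClass_eq_of_addLaw₁ _ _ hu (by simp [shift]) h

end Dual

/-! ### The pairing -/

section Pairing

variable {K : Type*} [Field K] {A B : K}

lemma logDer_formFun_hasValueAt (h2 : (2 : K) ≠ 0) {L : Fin 3 → K} {x y : K}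
    (h : (curve A B).Nonsingular x y) (hL : L 0 * x + L 1 * y + L 2 ≠ 0) :
    HasValueAt (logDer h2 (formFun A B L)) (.some x y h)
      ((L 0 * (2 * y) + L 1 * (3 * x ^ 2 + A)) / (L 0 * x + L 1 * y + L 2)) := by
  refine HasValueAt.div ?_ (formFun_hasValueAt L h) hL
  have := ((HasValueAt.const _ (L 0)).mul ((HasValueAt.const _ 2).mul (.yF h))).add
    ((HasValueAt.const _ (L 1)).mul (((HasValueAt.const _ 3).mul ((HasValueAt.xF h).pow 2)).add
      (.const _ A)))
  convert this using 1
  simp only [map_ofNat]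
  simp [formFun, invDer_xF, invDer_yF]

lemma one_sub_smul_eps_mul (c d : K) : ((1 : K[ε]) - c • DualNumber.eps) *
    (1 - d • DualNumber.eps) = 1 - (c + d) • DualNumber.eps := by
  ext <;> simp [add_comm]

lemma one_sub_smul_eps_pow (c : K) (n : ℕ) : ((1 : K[ε]) - c • DualNumber.eps) ^ n =
    1 - (n * c) • DualNumber.eps := by
  induction n with
  | zero => simp
  | succ n ih =>
    rw [pow_succ, ih, one_sub_smul_eps_mul]
    push_cast
    ring_nf

lemma odd_of_two_ne_zero (p : ℕ) [Fact p.Prime] [CharP K p] (h2 : (2 : K) ≠ 0) : Odd p := by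
  refine (Fact.out : p.Prime).odd_of_ne_two ?_
  rintro rfl
  exact h2 (by exact_mod_cast CharP.cast_eq_zero K 2)

lemma degree_single_sub_single (P : (curve A B).Point) :
    ((Finsupp.single P (1 : ℤ) - Finsupp.single 0 1).sum fun _ n => n) = 0 := by
  rw [Finsupp.sum_sub_index (fun _ _ _ => rfl)]
  simp

lemma yF_mul_ddx_div (h2 : (2 : K) ≠ 0) {f : (curve A B).FunctionField} {c : K}
    (hc : logDer h2 f = algebraMap K _ c) :
    yF A B * (ddx A B h2 f / f) = algebraMap K _ (c / 2) := by
  have h0 := two_ne_zero_functionField (A := A) (B := B) h2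
  rw [map_div₀, ← hc, logDer, invDer_apply, map_ofNat]
  field_simp

variable [DecidableEq K] {p : ℕ} {P R T : (curve A B).Point}

lemma single_apply_eq_zero {X W : (curve A B).Point} (hX : p • X = 0) (hW : p • W ≠ 0) (n : ℤ) :
    Finsupp.single X n W = 0 :=
  Finsupp.single_eq_of_ne (by rintro rfl; exact hW hX)

lemma nsmul_nsmul_eq_zero (hP : p • P = 0) (i : ℕ) : p • (i • P) = 0 := by
  rw [nsmul_left_comm, hP, nsmul_zero]

/-- The divisor of the numerator is supported on p-torsion points, and the evaluation point is not
p-torsion. -/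
lemma hNum_ne_zero (h2 : (2 : K) ≠ 0) (hP : p • P = 0) {x y : K} {h : (curve A B).Nonsingular x y}
    (hW : p • WeierstrassCurve.Affine.Point.some x y h ≠ 0) (i j : ℕ) :
    hNum p P i j 0 * x + hNum p P i j 1 * y + hNum p P i j 2 ≠ 0 := by
  have hi := nsmul_nsmul_eq_zero hP i
  have hj := nsmul_nsmul_eq_zero hP j
  have hv := formFun_hasValueAt (hNum p P i j) h
  rw [hNum] at hv ⊢
  split_ifs at hv ⊢
  · refine (hasDivisor_vertical h2 (i • P)).value_ne_zero ?_ hv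
    simp only [Finsupp.coe_sub, Finsupp.coe_add, Pi.sub_apply, Pi.add_apply,
      single_apply_eq_zero hi hW, single_apply_eq_zero (nsmul_zero p) hW,
      single_apply_eq_zero (X := -(i • P)) (by rw [smul_neg, hi, neg_zero]) hW]
    rfl
  · refine (hasDivisor_line h2 (i • P) (j • P)).value_ne_zero ?_ hv
    simp only [Finsupp.coe_sub, Finsupp.coe_add, Pi.sub_apply, Pi.add_apply,
      single_apply_eq_zero hi hW, single_apply_eq_zero hj hW,
      single_apply_eq_zero (nsmul_zero p) hW, single_apply_eq_zero (X := -(i • P + j • P))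
        (by rw [smul_neg, nsmul_add, hi, hj, add_zero, neg_zero]) hW]
    rfl

lemma hDen_ne_zero (h2 : (2 : K) ≠ 0) (hP : p • P = 0) {x y : K} {h : (curve A B).Nonsingular x y}
    (hW : p • WeierstrassCurve.Affine.Point.some x y h ≠ 0) (i j : ℕ) :
    hDen p P i j 0 * x + hDen p P i j 1 * y + hDen p P i j 2 ≠ 0 := by
  have hv := formFun_hasValueAt (hDen p P i j) h
  rw [hDen] at hv ⊢
  split_ifs at hv ⊢
  · simp
  · have hi := nsmul_nsmul_eq_zero hP (i + j)
    refine (hasDivisor_vertical h2 ((i + j) • P)).value_ne_zero ?_ hv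
    simp only [Finsupp.coe_sub, Finsupp.coe_add, Pi.sub_apply, Pi.add_apply,
      single_apply_eq_zero hi hW, single_apply_eq_zero (nsmul_zero p) hW,
      single_apply_eq_zero (X := -((i + j) • P)) (by rw [smul_neg, hi, neg_zero]) hW]
    rfl

/-- The translate `R - T` of the evaluation point, which is not a `p`-torsion point. -/
lemma exists_translate (hp : Odd p) (hR : p • R = 0) (hR2 : 2 • R ≠ 0) (hT : 2 • T = 0)
    (hT0 : T ≠ 0) : ∃ x y h, p • WeierstrassCurve.Affine.Point.some (W' := curve A B) x y h ≠ 0 ∧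
      (∀ k, dualAdd A B (infPt k) (liftPt R) ∈ dualPoints A B) ∧
      (∀ k, translate T (dualAdd A B (infPt k) (liftPt R)) = ⟦shift A k x y⟧) ∧
      translate T (liftPt R) = ⟦shift A 0 x y⟧ := by
  -- As p is odd, p(R - T) = -T.
  have hW : p • (R + -T) ≠ 0 := by
    obtain ⟨m, rfl⟩ := hp
    rw [nsmul_add, hR, zero_add, smul_neg, add_nsmul, mul_comm, mul_nsmul', hT, nsmul_zero,
      zero_add, one_nsmul, neg_ne_zero]
    exact hT0
  have hT' : 2 • -T = 0 := by rw [smul_neg, hT, neg_zero]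
  have hT0' : -T ≠ 0 := neg_ne_zero.mpr hT0
  rw [show translate T (liftPt R) = dualAdd A B (liftPt R) (liftPt (-T)) from rfl]
  simp only [translate]
  generalize -T = T' at *
  match R, T' with
  | .zero, _ => exact absurd (nsmul_zero 2) hR2
  | _, .zero => exact absurd rfl hT0'
  | .some x₁ y₁ h₁, .some x₂ y₂ h₂ =>
    -- Equal abscissas would give R = ±T and hence 2R = O. So R - T is computed by a chord.
    have hx : x₁ ≠ x₂ := by
      intro hx
      rcases WeierstrassCurve.Affine.Point.X_eq_iff (h₁ := h₁) (h₂ := h₂) |>.mp hx with he | he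
      · exact hR2 (he ▸ hT')
      · rw [he, smul_neg, hT', neg_zero] at hR2
        exact hR2 rfl
    obtain ⟨x₃, y₃, h₃, hadd, hd⟩ := dualAdd_shift_liftPt h₁ h₂ hx
    refine ⟨x₃, y₃, h₃, hadd ▸ hW, fun k => ?_, fun k => ?_, ?_⟩
    · rw [dualAdd_infPt_liftPt]
      exact shift_mem_dualPoints h₁.1
    · rw [dualAdd_infPt_liftPt, hd]
    · rw [liftPt_some h₁, hd]

lemma hDefined_of_translate_eq (h2 : (2 : K) ≠ 0) (hP : p • P = 0) {x y : K}
    {h : (curve A B).Nonsingular x y} (hW : p • WeierstrassCurve.Affine.Point.some x y h ≠ 0)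
    (i j : ℕ) {Q : PointClass K[ε]} {k : K} (hQ : translate T Q = ⟦shift A k x y⟧) :
    HDefined p T P i j Q := by
  rw [HDefined, hQ]
  refine ⟨shift_mem_dualPoints h.1, ⟨_, _, rfl⟩, _, rfl, ?_⟩
  rw [evalForm_shift]
  exact isUnit_of_fst_ne_zero (by simpa [fst_algebraMap] using hDen_ne_zero h2 hP hW i j)

lemma isUnit_hVal (h2 : (2 : K) ≠ 0) (hP : p • P = 0) {x y : K}
    {h : (curve A B).Nonsingular x y} (hW : p • WeierstrassCurve.Affine.Point.some x y h ≠ 0)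
    (i j : ℕ) {Q : PointClass K[ε]} {k : K} (hQ : translate T Q = ⟦shift A k x y⟧) :
    IsUnit (hVal p T P i j Q) := by
  rw [hVal, hQ]
  change IsUnit (evalForm _ _ * Ring.inverse (evalForm _ _))
  rw [evalForm_shift, evalForm_shift]
  refine (isUnit_of_fst_ne_zero ?_).mul (isUnit_of_fst_ne_zero ?_).ringInverse
  · simpa [fst_algebraMap] using hNum_ne_zero h2 hP hW i j
  · simpa [fst_algebraMap] using hDen_ne_zero h2 hP hW i j

lemma hFun_ne_zero (h2 : (2 : K) ≠ 0) (hP : p • P = 0) (i j : ℕ) : hFun p P i j ≠ 0 :=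
  (hasDivisor_hFun h2 hP i j).ne_zero h2

lemma exists_hVal_mul_inverse (h2 : (2 : K) ≠ 0) (hP : p • P = 0) {x y : K}
    {h : (curve A B).Nonsingular x y} (hW : p • WeierstrassCurve.Affine.Point.some x y h ≠ 0)
    (i j : ℕ) {Q Q₀ : PointClass K[ε]} {k : K} (hQ : translate T Q = ⟦shift A k x y⟧)
    (hQ₀ : translate T Q₀ = ⟦shift A 0 x y⟧) :
    ∃ c, HasValueAt (logDer h2 (hFun p P i j)) (.some x y h) c ∧
      hVal p T P i j Q * Ring.inverse (hVal p T P i j Q₀) = 1 - (k * c) • DualNumber.eps := by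
  have hN := hNum_ne_zero h2 hP hW i j
  have hD := hDen_ne_zero h2 hP hW i j
  refine ⟨_, ?_, by rw [hVal, hVal, hQ, hQ₀, ratio_mul_inverse_ratio hN hD]⟩
  rw [hFun, logDer_div h2 ((formFun_hasValueAt _ h).ne_zero hN)
    ((formFun_hasValueAt _ h).ne_zero hD)]
  exact (logDer_formFun_hasValueAt h2 h hN).sub (logDer_formFun_hasValueAt h2 h hD)

/-- The factors 1 - kcε multiply by adding c, just as the logarithmic derivative of a product adds
up. -/
lemma exists_prod_hVal (h2 : (2 : K) ≠ 0) (hP : p • P = 0) {x y : K}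
    {h : (curve A B).Nonsingular x y} (hW : p • WeierstrassCurve.Affine.Point.some x y h ≠ 0)
    (C : List (ℕ × ℕ)) {Q Q₀ : PointClass K[ε]} {k : K} (hQ : translate T Q = ⟦shift A k x y⟧)
    (hQ₀ : translate T Q₀ = ⟦shift A 0 x y⟧) :
    ∃ c, HasValueAt (logDer h2 (C.map fun s => hFun p P s.1 s.2).prod) (.some x y h) c ∧
      (C.map fun s => hVal p T P s.1 s.2 Q * Ring.inverse (hVal p T P s.1 s.2 Q₀)).prod =
        1 - (k * c) • DualNumber.eps := by
  induction C with
  | nil => exact ⟨0, by simpa [logDer_one] using HasValueAt.zero _, by simp⟩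
  | cons s C ih =>
    obtain ⟨c, hc, hprod⟩ := ih
    obtain ⟨d, hd, hval⟩ := exists_hVal_mul_inverse h2 hP hW s.1 s.2 hQ hQ₀
    have h0 : (C.map fun s => hFun p P s.1 s.2).prod ≠ 0 := by
      refine List.prod_ne_zero fun h0 => ?_
      obtain ⟨s, -, hs⟩ := List.mem_map.mp h0
      exact hFun_ne_zero h2 hP _ _ hs
    refine ⟨d + c, ?_, ?_⟩
    · rw [List.map_cons, List.prod_cons, logDer_mul h2 (hFun_ne_zero h2 hP _ _) h0]
      exact hd.add hc
    · rw [List.map_cons, List.prod_cons, hprod, hval, one_sub_smul_eps_mul, mul_add]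

lemma sum_single_sub_single (P : (curve A B).Point) :
    ((Finsupp.single P (1 : ℤ) - Finsupp.single 0 1).sum fun X n => n • X) = P := by
  rw [Finsupp.sum_sub_index (fun _ _ _ => sub_smul _ _ _)]
  simp

/-- The pairing is given by the constant logarithmic derivative of a function with the divisor
`p D`, for a divisor `D` of degree zero with sum `P`. -/
theorem pairing_infPt_eq [IsAlgClosed K] [Fact p.Prime] [CharP K p] (h2 : (2 : K) ≠ 0)
    (hE : 4 * A ^ 3 + 27 * B ^ 2 ≠ 0) (hR : p • R = 0) (hR2 : 2 • R ≠ 0) (hT : 2 • T = 0)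
    (hT0 : T ≠ 0) {C : List (ℕ × ℕ)} (hC : IsChainDecomposition p C) (hP : p • P = 0)
    {D : (curve A B).Point →₀ ℤ} (hdeg : (D.sum fun _ n => n) = 0)
    (hsum : (D.sum fun X n => n • X) = P) {f : (curve A B).FunctionField}
    (hf : HasDivisor f (p • D)) {c : K} (hc : logDer h2 f = algebraMap K _ c) (k : K) :
    pairing p R T C P (infPt k) = 1 - (k * c) • DualNumber.eps := by
  by_cases hk : k = 0
  · subst hk
    simp [pairing]
  obtain ⟨x, y, h, hW, -, hQ, hQ₀⟩ :=
    exists_translate (odd_of_two_ne_zero (K := K) p h2) hR hR2 hT hT0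
  have hfC := hC.hasDivisor h2 hP
  have hlog := logDer_eq_of_sum_eq p h2 hE hf hfC (by rw [hdeg, degree_single_sub_single])
    (by rw [hsum, sum_single_sub_single])
  -- Here the pairing is 1 by convention, which is consistent: with sum O the logarithmic derivative
  -- equals that of the constant 1.
  by_cases hP0 : P = 0
  · subst hP0
    have h1 := logDer_eq_of_sum_eq p h2 hE (f' := 1) (D' := 0) hf
      (by simpa using HasDivisor.one h2) hdeg hsum
    rw [hc, logDer_one, map_eq_zero] at h1
    simp [pairing, h1]
  · rw [pairing, if_neg (not_or.mpr ⟨hP0, fun h => hk (infPt_injective h)⟩)]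
    obtain ⟨d, hd, hprod⟩ := exists_prod_hVal h2 hP hW C (hQ k) hQ₀
    rw [hprod]
    -- The product yields the logarithmic derivative only at R - T; being constant, it is determined
    -- by this one value.
    rw [← hlog, hc] at hd
    rw [hd.unique (.const _ c)]

end Pairing

end DualPairing

/-! ### Deduction of the theorem -/

theorem theorem1 {K : Type*} [Field K] [IsAlgClosed K] [DecidableEq K]
    (p : ℕ) [Fact p.Prime] [CharP K p] (h2 : (2 : K) ≠ 0) (h3 : (3 : K) ≠ 0)
    (A B : K) (hE : 4 * A ^ 3 + 27 * B ^ 2 ≠ 0)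
    (R T : (curve A B).Point) (hR : p • R = 0) (hR2 : 2 • R ≠ 0)
    (hT : 2 • T = 0) (hT0 : T ≠ 0) :
    -- the map `e` is well defined: the values in the product make sense, and the values of `e`
    -- lie in `μ_p(K[ε])`
    (∀ C, IsChainDecomposition p C → ∀ P : (curve A B).Point, p • P = 0 → ∀ Q ∈ Θ K,
      dualAdd A B Q (liftPt R) ∈ dualPoints A B ∧
      (P ≠ 0 → Q ≠ infPt 0 → ∀ s ∈ C,
        HDefined p T P s.1 s.2 (dualAdd A B Q (liftPt R)) ∧
        HDefined p T P s.1 s.2 (liftPt R) ∧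
        IsUnit (hVal p T P s.1 s.2 (liftPt R))) ∧
      pairing p R T C P Q ^ p = 1) ∧
    -- the map `e` is independent of the addition chain decomposition
    (∀ C C', IsChainDecomposition p C → IsChainDecomposition p C' →
      ∀ P : (curve A B).Point, p • P = 0 → ∀ Q ∈ Θ K,
        pairing p R T C P Q = pairing p R T C' P Q) ∧
    -- the map `e` is bilinear
    (∀ C, IsChainDecomposition p C →
      (∀ P P' : (curve A B).Point, p • P = 0 → p • P' = 0 → ∀ Q ∈ Θ K,
        pairing p R T C (P + P') Q = pairing p R T C P Q * pairing p R T C P' Q) ∧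
      (∀ P : (curve A B).Point, p • P = 0 → ∀ Q ∈ Θ K, ∀ Q' ∈ Θ K,
        dualAdd A B Q Q' ∈ Θ K ∧
        pairing p R T C P (dualAdd A B Q Q') = pairing p R T C P Q * pairing p R T C P Q')) ∧
    -- the formula for `e`, with any divisor of degree zero that sums to `P` and any point `R'`
    (∀ C, IsChainDecomposition p C → ∀ P : (curve A B).Point, p • P = 0 →
      ∀ D : (curve A B).Point →₀ ℤ, (D.sum fun _ n => n) = 0 → (D.sum fun X n => n • X) = P →
      ∀ f : (curve A B).FunctionField, HasDivisor f (p • D) →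
      ∀ R' : (curve A B).Point, ∃ c : K, HasValueAt (yF A B * (ddx A B h2 f / f)) R' c ∧
        ∀ k : K, pairing p R T C P (infPt k) = 1 - (2 * c * k) • DualNumber.eps) ∧
    -- the map `e` depends neither on `R` nor on `T`
    (∀ R' T' : (curve A B).Point, p • R' = 0 → 2 • R' ≠ 0 → 2 • T' = 0 → T' ≠ 0 →
      ∀ C, IsChainDecomposition p C → ∀ P : (curve A B).Point, p • P = 0 → ∀ Q ∈ Θ K,
        pairing p R' T' C P Q = pairing p R T C P Q) := by
  have hodd := odd_of_two_ne_zero (K := K) p h2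
  have main {R' T' : (curve A B).Point} (hR : p • R' = 0) (hR2 : 2 • R' ≠ 0) (hT : 2 • T' = 0)
      (hT0 : T' ≠ 0) {C : List (ℕ × ℕ)} (hC : IsChainDecomposition p C) {P : (curve A B).Point}
      (hP : p • P = 0) {D : (curve A B).Point →₀ ℤ} (hdeg : (D.sum fun _ n => n) = 0)
      (hsum : (D.sum fun X n => n • X) = P) {f : (curve A B).FunctionField}
      (hf : HasDivisor f (p • D)) {c : K} (hc : logDer h2 f = algebraMap K _ c) (k : K) :=
    pairing_infPt_eq h2 hE hR hR2 hT hT0 hC hP hdeg hsum hf hc k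
  have chain {C : List (ℕ × ℕ)} (hC : IsChainDecomposition p C) {P : (curve A B).Point}
      (hP : p • P = 0) : ∃ f : (curve A B).FunctionField, ∃ c,
        HasDivisor f (p • (Finsupp.single P 1 - Finsupp.single 0 1)) ∧
          logDer h2 f = algebraMap K _ c := by
    have hf := hC.hasDivisor h2 hP
    obtain ⟨c, hc⟩ := exists_logDer_eq p h2 hE hf
    exact ⟨_, c, hf, hc⟩
  refine ⟨?_, ?_, ?_, ?_, ?_⟩
  · rintro C hC P hP _ ⟨k, rfl⟩
    obtain ⟨x, y, h, hW, hmem, hQ, hQ₀⟩ := exists_translate hodd hR hR2 hT hT0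
    refine ⟨hmem k, fun _ _ s _ => ⟨hDefined_of_translate_eq h2 hP hW _ _ (hQ k),
      hDefined_of_translate_eq h2 hP hW _ _ hQ₀, isUnit_hVal h2 hP hW _ _ hQ₀⟩, ?_⟩
    obtain ⟨f, c, hf, hc⟩ := chain hC hP
    rw [main hR hR2 hT hT0 hC hP (degree_single_sub_single P) (sum_single_sub_single P) hf hc,
      one_sub_smul_eps_pow, CharP.cast_eq_zero]
    simp
  · rintro C C' hC hC' P hP _ ⟨k, rfl⟩
    obtain ⟨f, c, hf, hc⟩ := chain hC hP
    rw [main hR hR2 hT hT0 hC hP (degree_single_sub_single P) (sum_single_sub_single P) hf hc,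
      main hR hR2 hT hT0 hC' hP (degree_single_sub_single P) (sum_single_sub_single P) hf hc]
  · refine fun C hC => ⟨?_, ?_⟩
    · rintro P P' hP hP' _ ⟨k, rfl⟩
      obtain ⟨f, c, hf, hc⟩ := chain hC hP
      obtain ⟨f', c', hf', hc'⟩ := chain hC hP'
      have hadd : p • (P + P') = 0 := by rw [nsmul_add, hP, hP', add_zero]
      -- The product of functions for P and P' has divisor p times (P) + (P') - 2(O). This sums to P
      -- + P' without being (P + P') - (O), so the freedom in the divisor is needed.
      have hff := hf.mul h2 hf'
      rw [← nsmul_add] at hff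
      rw [main hR hR2 hT hT0 hC hP (degree_single_sub_single P) (sum_single_sub_single P) hf hc,
        main hR hR2 hT hT0 hC hP' (degree_single_sub_single P') (sum_single_sub_single P') hf' hc',
        main hR hR2 hT hT0 hC hadd ?_ ?_ hff (c := c + c') ?_, one_sub_smul_eps_mul, mul_add]
      · rw [Finsupp.sum_add_index' (h := fun _ n => n) (fun _ => rfl) (fun _ _ _ => rfl), degree_single_sub_single,
          degree_single_sub_single, add_zero]
      · rw [Finsupp.sum_add_index' (h := fun X n => n • X) (fun _ => zero_smul _ _)
            (fun _ _ _ => add_smul _ _ _),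
          sum_single_sub_single, sum_single_sub_single]
      · rw [logDer_mul h2 (hf.ne_zero h2) (hf'.ne_zero h2), hc, hc', map_add]
    · rintro P hP _ ⟨k, rfl⟩ _ ⟨k', rfl⟩
      obtain ⟨f, c, hf, hc⟩ := chain hC hP
      rw [dualAdd_infPt_infPt]
      refine ⟨⟨_, rfl⟩, ?_⟩
      rw [main hR hR2 hT hT0 hC hP (degree_single_sub_single P) (sum_single_sub_single P) hf hc,
        main hR hR2 hT hT0 hC hP (degree_single_sub_single P) (sum_single_sub_single P) hf hc,
        main hR hR2 hT hT0 hC hP (degree_single_sub_single P) (sum_single_sub_single P) hf hc,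
        one_sub_smul_eps_mul, add_mul]
  · intro C hC P hP D hdeg hsum f hf R'
    obtain ⟨c, hc⟩ := exists_logDer_eq p h2 hE hf
    -- The constant `c` is 2y f'/f, so the value of y f'/f is its half at every point.
    refine ⟨c / 2, ?_, fun k => ?_⟩
    · rw [yF_mul_ddx_div h2 hc]
      exact .const R' _
    · rw [main hR hR2 hT hT0 hC hP hdeg hsum hf hc, mul_div_cancel₀ _ h2, mul_comm]
  · rintro R' T' hR' hR2' hT' hT0' C hC P hP _ ⟨k, rfl⟩
    obtain ⟨f, c, hf, hc⟩ := chain hC hP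
    rw [main hR hR2 hT hT0 hC hP (degree_single_sub_single P) (sum_single_sub_single P) hf hc,
      main hR' hR2' hT' hT0' hC hP (degree_single_sub_single P) (sum_single_sub_single P) hf hc]
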